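/- Let $K\subset\mathbb{R}$ be a subfield, let $n\ge 2$ and $0\le l\le m$ be integers, let $d$ be an even natural number, and let $f_1,\dots,f_m,g\in K[x_1,\dots,x_n]$ have total degree at most $d$. Put $$E=\{x\in\mathbb{R}^n \mid f_1(x)=\dots=f_l(x)=0,\ f_{l+1}(x)\ge 0,\dots,f_m(x)\ge 0\}.$$ Suppose that $g$ attains a minimum value $g_{\min}$ on $E$ and that $E^{\min}=\{x\in E\mid g(x)=g_{\min}\}$ has at least one compact connected component. Let $q_0=n+1$, let $q_1<\dots<q_m$ be the first $m$ primes greater than $n+1$, and put $a_{ij}=\frac{1}{q_i-j}$ for $0\le i\le m$, $0\le j\le n$. Let $T_d$ be the Chebyshev polynomial (of the first kind) of degree $d$, and set $$\tilde g(x)=\sum_{j=1}^n a_{0j}T_d(x_j),\qquad \tilde f_i(x)=a_{i0}+\sum_{j=1}^n a_{ij}\,(T_d(x_j)+1)\quad(1\le i\le m),$$ $$G(t,x)=t\,g(x)+(1-t)\,\tilde g(x),\qquad F_i^{\pm}(t,x)=t\,f_i(x)\pm(1-t)\,\tilde f_i(x).$$ For $S\subset\{1,\dots,m\}$ and $\sigma\in\{+,-\}^S$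 let $$\hat V_{S,\sigma}=\Big\{(t,x,\lambda)\in\mathbb{A}^1_{\mathbb{C}}\times\mathbb{A}^n_{\mathbb{C}}\times\mathbb{P}^{|S|}_{\mathbb{C}}\ \Big|\ F_i^{\sigma_i}(t,x)=0\ \text{for all } i\in S,\ \ \lambda_0\nabla_xG(t,x)=\sum_{i\in S}\lambda_i\nabla_xF_i^{\sigma_i}(t,x)\Big\},$$ and let $V_{S,\sigma}$ be the union of those irreducible components (for the Zariski topology) of $\hat V_{S,\sigma}$ that are not contained in $\{t=t_0\}$ for any $t_0\in\mathbb{C}$. Let $\mathcal{S}$ be the set of pairs $(S,\sigma)$ with $S\subset\{1,\dots,m\}$, $|S|\le n$, $\sigma\in\{+,-\}^S$ and $\sigma_i=+$ for every $i\in S$ with $i>l$. Let $\Pi_x$ denote the projection $(t,x,\lambda)\mapsto x$. Then the set $$\bigcup_{(S,\sigma)\in\mathcal{S}}\Pi_x\big(V_{S,\sigma}\cap\{t=1\}\big)\subset\mathbb{C}^n$$ is finite, and it contains a point of every compact connected component of $E^{\min}$ (where $\mathbb{R}^n\subset\mathbb{C}^n$). -/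

import Mathlib

namespace PolyMin

/-! ### The optimization problem -/

/-- The basic closed semialgebraic set defined by `f i = 0` for the first `l` indices `i` and
`f i ≥ 0` for the remaining ones. -/
def feasibleSet {K : Subfield ℝ} {n m : ℕ} (l : ℕ) (f : Fin m → MvPolynomial (Fin n) K) :
    Set (Fin n → ℝ) :=
  {x | (∀ i : Fin m, i.val < l → MvPolynomial.aeval x (f i) = 0) ∧
    ∀ i : Fin m, l ≤ i.val → 0 ≤ MvPolynomial.aeval x (f i)}

/-- The points of `E` at which `g` takes the value `gmin`. -/
def minimizerSet {K : Subfield ℝ} {n : ℕ} (E : Set (Fin n → ℝ)) (g : MvPolynomial (Fin n) K)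
    (gmin : ℝ) : Set (Fin n → ℝ) :=
  {x ∈ E | MvPolynomial.aeval x g = gmin}

/-- `C` is a connected component of the subset `A`. -/
def IsConnectedComponentOf {X : Type*} [TopologicalSpace X] (C A : Set X) : Prop :=
  ∃ x ∈ A, C = connectedComponentIn A x

/-! ### The Cauchy matrix and the initial polynomials of the deformation -/

/-- `q 0 = n + 1`, and `q 1 < q 2 < ⋯` are the primes greater than `n + 1`, in order. -/
noncomputable def q (n : ℕ) : ℕ → ℕ
  | 0 => n + 1
  | i + 1 => Nat.nth (fun p => p.Prime ∧ n + 1 < p) i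

/-- The entries `a i j = 1 / (q i - j)` of the Cauchy matrix, `0 ≤ i ≤ m` and `0 ≤ j ≤ n`. -/
noncomputable def a (n i j : ℕ) : ℚ := 1 / ((q n i : ℚ) - (j : ℚ))

/-- The Chebyshev polynomial `T_d` in the variable `x j`. -/
noncomputable def chebVar {n : ℕ} (d : ℕ) (j : Fin n) : MvPolynomial (Fin n) ℂ :=
  Polynomial.aeval (MvPolynomial.X j) (Polynomial.Chebyshev.T ℂ (d : ℤ))

/-- `g̃ = ∑_{1 ≤ j ≤ n} a 0 j * T_d(x_j)`; the index `j : Fin n` stands for column `j + 1`. -/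
noncomputable def gTilde (n d : ℕ) : MvPolynomial (Fin n) ℂ :=
  ∑ j : Fin n, MvPolynomial.C ((a n 0 (j.val + 1) : ℚ) : ℂ) * chebVar d j

/-- `f̃_i = a i 0 + ∑_{1 ≤ j ≤ n} a i j * (T_d(x_j) + 1)`; the index `i : Fin m` stands for
row `i + 1`. -/
noncomputable def fTilde (n d : ℕ) {m : ℕ} (i : Fin m) : MvPolynomial (Fin n) ℂ :=
  MvPolynomial.C ((a n (i.val + 1) 0 : ℚ) : ℂ) +
    ∑ j : Fin n, MvPolynomial.C ((a n (i.val + 1) (j.val + 1) : ℚ) : ℂ) * (chebVar d j + 1)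

/-- A polynomial with coefficients in `K ⊆ ℝ`, seen with complex coefficients. -/
noncomputable def toComplex {K : Subfield ℝ} {n : ℕ} (p : MvPolynomial (Fin n) K) :
    MvPolynomial (Fin n) ℂ :=
  MvPolynomial.map (algebraMap K ℂ) p

/-- `G(t, x) = t g(x) + (1 - t) g̃(x)`, as a polynomial in `x` for each `t`. -/
noncomputable def G {K : Subfield ℝ} {n : ℕ} (d : ℕ) (g : MvPolynomial (Fin n) K) (t : ℂ) :
    MvPolynomial (Fin n) ℂ :=
  MvPolynomial.C t * toComplex g + MvPolynomial.C (1 - t) * gTilde n d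

/-- `F_i^±(t, x) = t f_i(x) ± (1 - t) f̃_i(x)`, as a polynomial in `x` for each `t`; the sign is
the unit `ε = ±1` of `ℤ`. -/
noncomputable def F {K : Subfield ℝ} {n m : ℕ} (d : ℕ) (f : Fin m → MvPolynomial (Fin n) K)
    (i : Fin m) (ε : ℤˣ) (t : ℂ) : MvPolynomial (Fin n) ℂ :=
  MvPolynomial.C t * toComplex (f i) +
    MvPolynomial.C (((ε : ℤ) : ℂ) * (1 - t)) * fTilde n d i

/-! ### The space `𝔸 × 𝔸ⁿ × ℙˢ` with its Zariski topology -/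

/-- The set of complex points of `𝔸 × 𝔸ⁿ × ℙ^|ι|`. The homogeneous coordinates of the last factor
are indexed by `Option ι`: `none` for `λ_0` and `some i` for `λ_i`. -/
structure TXL (n : ℕ) (ι : Type) where
  t : ℂ
  x : Fin n → ℂ
  lam : Projectivization ℂ (Option ι → ℂ)

/-- The variables `t` (`Sum.inl none`), `x_j` (`Sum.inl (some j)`), `λ_0` (`Sum.inr none`) and
`λ_i` (`Sum.inr (some i)`). -/
abbrev TXLVar (n : ℕ) (ι : Type) : Type := Option (Fin n) ⊕ Option ι

/-- `p` is homogeneous, of some degree, in the group of variables `λ`. -/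
def IsLamHomogeneous {n : ℕ} {ι : Type} (p : MvPolynomial (TXLVar n ι) ℂ) : Prop :=
  ∃ k : ℕ, MvPolynomial.IsWeightedHomogeneous
    (Sum.elim (fun _ => 0) (fun _ => 1) : TXLVar n ι → ℕ) p k

/-- The zero set of a polynomial that is homogeneous in `λ` (its vanishing does not depend on the
representative of the projective point). -/
def zeroSet {n : ℕ} {ι : Type} (p : MvPolynomial (TXLVar n ι) ℂ) : Set (TXL n ι) :=
  {P | MvPolynomial.eval (Sum.elim (fun o => o.elim P.t P.x) P.lam.rep) p = 0}

/-- The Zariski topology: the closed sets are the common zero sets of families of polynomials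
that are homogeneous in `λ`. -/
instance zariskiTopology (n : ℕ) (ι : Type) : TopologicalSpace (TXL n ι) :=
  TopologicalSpace.generateFrom
    {U | ∃ p : MvPolynomial (TXLVar n ι) ℂ, IsLamHomogeneous p ∧ U = (zeroSet p)ᶜ}

/-- The irreducible components of a subset: its maximal irreducible subsets. -/
def componentsOf {X : Type*} [TopologicalSpace X] (A : Set X) : Set (Set X) :=
  {Z | Maximal (fun Z : Set X => IsIrreducible Z ∧ Z ⊆ A) Z}

/-! ### The varieties of the deformation -/

/-- The variety `V̂_{S,σ}` of all `(t, x, λ)` with `F_i^{σ_i}(t, x) = 0` for `i ∈ S` and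
`λ_0 ∇_x G(t, x) = ∑_{i ∈ S} λ_i ∇_x F_i^{σ_i}(t, x)`. -/
def hatV {K : Subfield ℝ} {n m : ℕ} (d : ℕ) (f : Fin m → MvPolynomial (Fin n) K)
    (g : MvPolynomial (Fin n) K) (S : Finset (Fin m)) (σ : S → ℤˣ) : Set (TXL n S) :=
  {P | (∀ i : S, MvPolynomial.eval P.x (F d f i.val (σ i) P.t) = 0) ∧
    ∀ j : Fin n,
      P.lam.rep none * MvPolynomial.eval P.x (MvPolynomial.pderiv j (G d g P.t)) =
        ∑ i : S, P.lam.rep (some i) *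
          MvPolynomial.eval P.x (MvPolynomial.pderiv j (F d f i.val (σ i) P.t))}

/-- The variety `V_{S,σ}`: the union of the irreducible components of `V̂_{S,σ}` that are not
included in `{t = t₀}` for any `t₀ ∈ ℂ`. -/
def V {K : Subfield ℝ} {n m : ℕ} (d : ℕ) (f : Fin m → MvPolynomial (Fin n) K)
    (g : MvPolynomial (Fin n) K) (S : Finset (Fin m)) (σ : S → ℤˣ) : Set (TXL n S) :=
  ⋃₀ {Z | Z ∈ componentsOf (hatV d f g S σ) ∧ ¬ ∃ t₀ : ℂ, Z ⊆ {P | P.t = t₀}}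

/-- The set `𝒮` of pairs `(S, σ)` with `|S| ≤ n` and `σ_i = +` for the indices `i ∈ S` of
inequalities. -/
def signedSubsets (n m l : ℕ) : Set (Σ S : Finset (Fin m), (S → ℤˣ)) :=
  {p | p.1.card ≤ n ∧ ∀ i : p.1, l ≤ i.val.val → p.2 i = 1}

/-- The union over `(S, σ) ∈ 𝒮` of the sets `Π_x(V_{S,σ} ∩ {t = 1}) ⊆ ℂⁿ`. -/
def sampleSet {K : Subfield ℝ} {n m : ℕ} (l d : ℕ) (f : Fin m → MvPolynomial (Fin n) K)
    (g : MvPolynomial (Fin n) K) : Set (Fin n → ℂ) :=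
  ⋃ p ∈ signedSubsets n m l, TXL.x '' (V d f g p.1 p.2 ∩ {P | P.t = 1})

end PolyMin

/-! Finiteness. At `t = 0` the system has no solution at infinity. Up to signs absorbed into `λ`,
its leading forms are `∑_j a_ij x_j^d` for `i ∈ S` and `x_j^(d-1) ∑_k a_kj λ_k`. Let `B` be the
support of `x`. If `|B| > |S|`, the second family forces `λ = 0`; if `|B| ≤ |S|`, the first forces
`x = 0`. Both hold because square submatrices of a Cauchy matrix are invertible
(`cauchy_ker_eq_zero`).

The algebraic form of this is `exists_affineSpan_pow_mul_le_perturbed`: over `ℂ[t]`, monomials in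
`x` of high degree times the `λ_k` drop in degree modulo `t`. Nakayama and Cayley–Hamilton
(`exists_monic_aeval_mul_eq_zero`) then yield a nonzero `Φ` with `Φ(t, x_j) = 0` on all of `V̂`
(`exists_relation_hatV`). Once powers of `t - 1` are cancelled, the relation still holds on every
component not inside `{t = 1}`, and leaves finitely many values of `x_j` at `t = 1`
(`finite_image_V`).

Sample points. A compact component `C` of the minimizers is isolated inside a compact `L` whose
boundary contains no minimizer (`exists_compact_of_compact_component`). For `t < 1` close to `1`,
minimize `G` over the part of `L` where the relaxed constraints hold. Limits of these minimizers as
`t → 1` are minimizers of `g` on `E`, hence interior to `L`, so the approximating points satisfy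
first order conditions and lie in some `V̂_{S,σ}` (`exists_mem_hatV_of_minimizer`). A limit of
points of `V̂` with `t ≠ 1` belongs to `V` (`mkPoint_mem_V_of_tendsto`). This places sample points
in every neighbourhood of `C`; as the sample set is finite, one lies in `C`. -/

namespace PolyMin

open MvPolynomial Topology Filter

/-! ### The Zariski topology on `𝔸 × 𝔸ⁿ × ℙˢ` -/

section Zariski

variable {n : ℕ} {ι : Type}

/-- The affine coordinates `(t, x)` of a point. -/
def TXL.base (P : TXL n ι) : Option (Fin n) → ℂ := fun o => o.elim P.t P.x

/-- All the coordinates `(t, x, λ)` of a point, for the chosen representative of `λ`. -/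
noncomputable def TXL.coords (P : TXL n ι) : TXLVar n ι → ℂ := Sum.elim P.base P.lam.rep

theorem isWeightedHomogeneous_rename_inl (p : MvPolynomial (Option (Fin n)) ℂ) :
    IsWeightedHomogeneous (Sum.elim (fun _ => 0) (fun _ => 1) : TXLVar n ι → ℕ)
      (rename Sum.inl p) 0 := by
  induction p using MvPolynomial.induction_on with
  | C a => simpa using isWeightedHomogeneous_C _ a
  | add p q hp hq => simpa using hp.add hq
  | mul_X p i hp =>
    simpa using hp.mul (isWeightedHomogeneous_X ℂ
      (Sum.elim (fun _ => 0) (fun _ => 1) : TXLVar n ι → ℕ) (Sum.inl i))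

theorem isClosed_zeroSet {p : MvPolynomial (TXLVar n ι) ℂ} (hp : IsLamHomogeneous p) :
    IsClosed (zeroSet p) :=
  ⟨TopologicalSpace.isOpen_generateFrom_of_mem ⟨p, hp, rfl⟩⟩

theorem isClosed_base_zeros (p : MvPolynomial (Option (Fin n)) ℂ) :
    IsClosed {P : TXL n ι | eval P.base p = 0} := by
  have h : {P : TXL n ι | eval P.base p = 0} = zeroSet (rename Sum.inl p) := by
    ext P
    simp only [zeroSet, Set.mem_ofPred_eq, eval_rename, Sum.elim_comp_inl]
    rfl
  rw [h]
  exact isClosed_zeroSet ⟨0, isWeightedHomogeneous_rename_inl p⟩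

theorem isClosed_linear_zeros [Fintype ι] (p : Option ι → MvPolynomial (Option (Fin n)) ℂ) :
    IsClosed {P : TXL n ι | ∑ k, P.lam.rep k * eval P.base (p k) = 0} := by
  have h : {P : TXL n ι | ∑ k, P.lam.rep k * eval P.base (p k) = 0} =
      zeroSet (∑ k, X (Sum.inr k) * rename Sum.inl (p k)) := by
    ext P
    simp only [zeroSet, Set.mem_ofPred_eq, map_sum, map_mul, eval_X, eval_rename,
      Sum.elim_comp_inl, Sum.elim_inr]
    rfl
  rw [h]
  refine isClosed_zeroSet ⟨1, IsWeightedHomogeneous.sum _ _ _ fun k _ => ?_⟩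
  simpa using (isWeightedHomogeneous_X ℂ
    (Sum.elim (fun _ => 0) (fun _ => 1) : TXLVar n ι → ℕ) (Sum.inr k)).mul
      (isWeightedHomogeneous_rename_inl (p k))

/-- A point of `𝔸 × 𝔸ⁿ × ℙˢ`, as the maximal ideal of the polynomials that vanish at its chosen
coordinates. -/
noncomputable def toSpec (P : TXL n ι) : PrimeSpectrum (MvPolynomial (TXLVar n ι) ℂ) :=
  ⟨RingHom.ker (eval P.coords), RingHom.ker_isPrime _⟩

/-- The topology pulled back from the spectrum of a Noetherian polynomial ring is Noetherian and
finer than the Zariski topology. It depends on the chosen representatives of `λ`, which is harmless: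
a topology coarser than a Noetherian one is Noetherian. -/
instance noetherianSpace [Finite ι] : TopologicalSpace.NoetherianSpace (TXL n ι) := by
  let τ : TopologicalSpace (TXL n ι) := TopologicalSpace.induced toSpec inferInstance
  have hle : τ ≤ zariskiTopology n ι := by
    refine le_generateFrom ?_
    rintro U ⟨p, -, rfl⟩
    refine ⟨(PrimeSpectrum.zeroLocus {p})ᶜ, (PrimeSpectrum.isClosed_zeroLocus _).isOpen_compl, ?_⟩
    ext P
    simp only [Set.preimage_compl, Set.mem_compl_iff, Set.mem_preimage,
      PrimeSpectrum.mem_zeroLocus, Set.singleton_subset_iff, SetLike.mem_coe, zeroSet,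
      Set.mem_ofPred_eq]
    rfl
  have hN : @TopologicalSpace.NoetherianSpace _ τ :=
    @Topology.IsInducing.noetherianSpace (PrimeSpectrum (MvPolynomial (TXLVar n ι) ℂ)) _ _ τ _
      toSpec (@Topology.IsInducing.mk _ _ τ _ toSpec rfl)
  exact @TopologicalSpace.noetherianSpace_of_surjective _ _ τ (zariskiTopology n ι) hN id
    (@Continuous.mk _ _ τ (zariskiTopology n ι) _ fun s hs => hle s hs) Function.surjective_id

/-- The point with homogeneous coordinates `v`. -/
noncomputable def mkPoint (z : ℂ × (Fin n → ℂ) × {v : Option ι → ℂ // v ≠ 0}) : TXL n ι :=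
  ⟨z.1, z.2.1, Projectivization.mk ℂ z.2.2.1 z.2.2.2⟩

theorem eval_smul_of_isWeightedHomogeneous {p : MvPolynomial (TXLVar n ι) ℂ} {k : ℕ}
    (hp : IsWeightedHomogeneous (Sum.elim (fun _ => 0) (fun _ => 1) : TXLVar n ι → ℕ) p k)
    (b : Option (Fin n) → ℂ) (v : Option ι → ℂ) (c : ℂ) :
    eval (Sum.elim b (c • v)) p = c ^ k * eval (Sum.elim b v) p := by
  rw [eval_eq, eval_eq, Finset.mul_sum]
  refine Finset.sum_congr rfl fun s hs => ?_
  have hk := hp (mem_support_iff.1 hs)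
  rw [mul_left_comm]
  congr 1
  rw [← hk, Finsupp.weight_apply, Finsupp.sum, ← Finset.prod_pow_eq_pow_sum, ← Finset.prod_mul_distrib]
  refine Finset.prod_congr rfl fun i _ => ?_
  rcases i with i | i
  · simp
  · simp [mul_pow]

theorem mkPoint_mem_zeroSet {p : MvPolynomial (TXLVar n ι) ℂ} (hp : IsLamHomogeneous p)
    (z : ℂ × (Fin n → ℂ) × {v : Option ι → ℂ // v ≠ 0}) :
    mkPoint z ∈ zeroSet p ↔
      eval (Sum.elim (fun o => o.elim z.1 z.2.1) z.2.2.1 : TXLVar n ι → ℂ) p = 0 := by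
  obtain ⟨k, hk⟩ := hp
  obtain ⟨a, ha⟩ := Projectivization.exists_smul_eq_mk_rep ℂ z.2.2.1 z.2.2.2
  have : (mkPoint z).lam.rep = (a : ℂ) • z.2.2.1 := ha.symm
  simp only [zeroSet, Set.mem_ofPred_eq, this]
  rw [eval_smul_of_isWeightedHomogeneous hk]
  simp [mkPoint]

/-- The Zariski topology is coarser than the classical one. -/
theorem continuous_mkPoint : Continuous (mkPoint : _ → TXL n ι) := by
  refine continuous_generateFrom_iff.2 ?_
  rintro U ⟨p, hp, rfl⟩
  have : mkPoint ⁻¹' (zeroSet p)ᶜ = {z : ℂ × (Fin n → ℂ) × {v : Option ι → ℂ // v ≠ 0} |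
      eval (Sum.elim (fun o => o.elim z.1 z.2.1) z.2.2.1 : TXLVar n ι → ℂ) p ≠ 0} := by
    ext z
    simp [mkPoint_mem_zeroSet hp]
  rw [this]
  refine isOpen_ne_fun ((MvPolynomial.continuous_eval p).comp (continuous_pi ?_)) continuous_const
  rintro ((_ | i) | i)
  · exact continuous_fst
  · exact (continuous_apply i).comp (continuous_fst.comp continuous_snd)
  · exact (continuous_apply i).comp
      (continuous_subtype_val.comp (continuous_snd.comp continuous_snd))

end Zariski

/-! ### The closed sets `V̂_{S,σ}` -/

section HatV

variable {K : Subfield ℝ} {n m : ℕ} {d : ℕ} {f : Fin m → MvPolynomial (Fin n) K}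
  {g : MvPolynomial (Fin n) K} {S : Finset (Fin m)} {σ : S → ℤˣ}

theorem exists_eval_base_G (d : ℕ) (g : MvPolynomial (Fin n) K) (j : Fin n) :
    ∃ p : MvPolynomial (Option (Fin n)) ℂ, ∀ (ι : Type) (P : TXL n ι),
      eval P.base p = eval P.x (pderiv j (G d g P.t)) := by
  refine ⟨X none * rename some (pderiv j (toComplex g)) +
    (1 - X none) * rename some (pderiv j (gTilde n d)), fun ι P => ?_⟩
  simp [G, eval_rename, TXL.base, Function.comp_def]

theorem exists_eval_base_F (d : ℕ) (f : Fin m → MvPolynomial (Fin n) K) (i : Fin m) (ε : ℤˣ) :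
    ∃ p : MvPolynomial (Option (Fin n)) ℂ, ∀ (ι : Type) (P : TXL n ι),
      eval P.base p = eval P.x (F d f i ε P.t) := by
  refine ⟨X none * rename some (toComplex (f i)) +
    C ((ε : ℤ) : ℂ) * (1 - X none) * rename some (fTilde n d i), fun ι P => ?_⟩
  simp [F, eval_rename, TXL.base, Function.comp_def]

theorem exists_eval_base_pderiv_F (d : ℕ) (f : Fin m → MvPolynomial (Fin n) K) (i : Fin m)
    (ε : ℤˣ) (j : Fin n) :
    ∃ p : MvPolynomial (Option (Fin n)) ℂ, ∀ (ι : Type) (P : TXL n ι),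
      eval P.base p = eval P.x (pderiv j (F d f i ε P.t)) := by
  refine ⟨X none * rename some (pderiv j (toComplex (f i))) +
    C ((ε : ℤ) : ℂ) * (1 - X none) * rename some (pderiv j (fTilde n d i)), fun ι P => ?_⟩
  simp only [F, map_add, pderiv_C_mul]
  simp [eval_rename, TXL.base, Function.comp_def]

theorem isClosed_hatV : IsClosed (hatV d f g S σ) := by
  choose pG hG using exists_eval_base_G (n := n) d g
  choose pF hF using exists_eval_base_F (n := n) d f
  choose pD hD using exists_eval_base_pderiv_F (n := n) d f
  have h : hatV d f g S σ = (⋂ i : S, {P : TXL n S | eval P.base (pF i (σ i)) = 0}) ∩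
      ⋂ j : Fin n, {P : TXL n S | ∑ k, P.lam.rep k * eval P.base
        (Option.elim k (pG j) fun i : S => -pD i (σ i) j) = 0} := by
    ext P
    simp only [hatV, Set.mem_ofPred_eq, Set.mem_inter_iff, Set.mem_iInter, Fintype.sum_option,
      Option.elim_none, Option.elim_some, map_neg, hG, hF, hD, mul_neg, Finset.sum_neg_distrib,
      ← sub_eq_add_neg, sub_eq_zero]
  rw [h]
  exact (isClosed_iInter fun i => isClosed_base_zeros _).inter
    (isClosed_iInter fun j => isClosed_linear_zeros _)

theorem mkPoint_mem_hatV {t : ℂ} {x : Fin n → ℂ} {v : Option S → ℂ} (hv : v ≠ 0)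
    (hF : ∀ i : S, eval x (F d f i (σ i) t) = 0)
    (hD : ∀ j : Fin n, v none * eval x (pderiv j (G d g t)) =
      ∑ i : S, v (some i) * eval x (pderiv j (F d f i (σ i) t))) :
    mkPoint ⟨t, x, v, hv⟩ ∈ hatV d f g S σ := by
  obtain ⟨a, ha⟩ := Projectivization.exists_smul_eq_mk_rep ℂ v hv
  refine ⟨hF, fun j => ?_⟩
  have : (mkPoint ⟨t, x, v, hv⟩ : TXL n S).lam.rep = (a : ℂ) • v := ha.symm
  simp only [this, Pi.smul_apply, smul_eq_mul, mul_assoc, ← Finset.mul_sum]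
  exact congrArg _ (hD j)

/-- Every irreducible subset of a closed subset of a Noetherian space lies in a component. -/
theorem exists_mem_componentsOf_superset {X : Type*} [TopologicalSpace X]
    [TopologicalSpace.NoetherianSpace X] {A W : Set X} (hA : IsClosed A) (hW : IsIrreducible W)
    (hWA : W ⊆ A) : ∃ Z ∈ componentsOf A, W ⊆ Z := by
  obtain ⟨T, hTf, hTc, hTi, rfl⟩ :=
    TopologicalSpace.NoetherianSpace.exists_finite_set_isClosed_irreducible hA
  have key : ∀ W : Set X, IsIrreducible W → W ⊆ ⋃₀ T → ∃ Z ∈ T, W ⊆ Z := fun W hW hWT => by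
    simpa using isIrreducible_iff_sUnion_isClosed.1 hW hTf.toFinset (by simpa using hTc)
      (by simpa using hWT)
  obtain ⟨Z, hZ, hWZ⟩ := key W hW hWA
  obtain ⟨Y, hZY, hY⟩ := hTf.exists_le_maximal hZ
  refine ⟨Y, ⟨⟨hTi Y hY.prop, Set.subset_sUnion_of_mem hY.prop⟩, ?_⟩, hWZ.trans hZY⟩
  rintro B ⟨hB, hBT⟩ hYB
  obtain ⟨Y', hY', hBY'⟩ := key B hB hBT
  exact hBY'.trans (hY.le_of_ge hY' (hYB.trans hBY'))

/-- A limit at `t = 1`, in the classical topology, of points of `V̂_{S,σ}` with `t ≠ 1` lies in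
`V_{S,σ}`. -/
theorem mkPoint_mem_V_of_tendsto {α : Type*} {l : Ultrafilter α}
    {z : α → ℂ × (Fin n → ℂ) × {v : Option S → ℂ // v ≠ 0}}
    {z₀ : ℂ × (Fin n → ℂ) × {v : Option S → ℂ // v ≠ 0}} (hz : Tendsto z l (𝓝 z₀))
    (hmem : ∀ᶠ k in (l : Filter α), mkPoint (z k) ∈ hatV d f g S σ)
    (hne : ∀ᶠ k in (l : Filter α), (z k).1 ≠ z₀.1) :
    mkPoint z₀ ∈ V d f g S σ := by
  obtain ⟨T, hTf, hTc, hTi, hT⟩ :=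
    TopologicalSpace.NoetherianSpace.exists_finite_set_isClosed_irreducible
      (isClosed_hatV (d := d) (f := f) (g := g) (S := S) (σ := σ))
  -- Finitely many closed irreducible pieces cover `V̂`, so the ultrafilter selects one of them. It
  -- contains the limit too, being Zariski closed and hence classically closed.
  have : ∃ Y ∈ T, ∀ᶠ k in (l : Filter α), mkPoint (z k) ∈ Y := by
    have h : (⋃ Y ∈ T, {k | mkPoint (z k) ∈ Y}) ∈ l := by
      filter_upwards [hmem] with k hk
      rw [hT] at hk
      simpa using hk
    obtain ⟨Y, hY, h⟩ := (Ultrafilter.finite_biUnion_mem_iff hTf).1 h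
    exact ⟨Y, hY, h⟩
  obtain ⟨Y, hY, hYz⟩ := this
  have hlim : Tendsto (fun k => mkPoint (z k)) l (𝓝 (mkPoint z₀)) :=
    (continuous_mkPoint.tendsto z₀).comp hz
  obtain ⟨Z, hZ, hYZ⟩ := exists_mem_componentsOf_superset isClosed_hatV (hTi Y hY)
    (hT ▸ Set.subset_sUnion_of_mem hY : Y ⊆ hatV d f g S σ)
  refine ⟨Z, ⟨hZ, ?_⟩, hYZ ((hTc Y hY).mem_of_tendsto hlim hYz)⟩
  -- The component contains the limit and also points whose `t` differs from that of the limit, so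
  -- `t` is not constant on it.
  rintro ⟨t₀, ht₀⟩
  obtain ⟨k, hk, hk'⟩ := (hYz.and hne).exists
  have h1 : (z k).1 = t₀ := ht₀ (hYZ hk)
  have h2 : z₀.1 = t₀ := ht₀ (hYZ ((hTc Y hY).mem_of_tendsto hlim hYz))
  exact hk' (h1.trans h2.symm)

end HatV

end PolyMin

namespace PolyMin

/-! ### Cauchy matrices -/

section Cauchy

variable {k κ ν : Type*} [Field k] [Fintype κ] [Fintype ν]

/-- The numerator `N` of `∑ c_j / (z - r_j)` has degree less than the number of its zeros `p_i`, so
it vanishes. Its value at `r_j` is `c_j` times a nonzero product. -/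
theorem cauchy_ker_eq_zero {p : κ → k} {r : ν → k} (hp : Function.Injective p)
    (hr : Function.Injective r) (hpr : ∀ i j, p i ≠ r j) (hcard : Fintype.card ν = Fintype.card κ)
    {c : ν → k} (hc : ∀ i, ∑ j, 1 / (p i - r j) * c j = 0) : c = 0 := by
  classical
  set N : Polynomial k := ∑ j, Polynomial.C (c j) *
    ∏ l ∈ Finset.univ.erase j, (Polynomial.X - Polynomial.C (r l)) with hN
  have hdeg : N.degree < Fintype.card κ := by
    rw [← hcard]
    refine (Polynomial.degree_sum_le _ _).trans_lt ((Finset.sup_lt_iff (by simp)).2 fun j _ => ?_)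
    refine (Polynomial.degree_mul_le _ _).trans_lt ?_
    refine (add_le_add Polynomial.degree_C_le le_rfl).trans_lt ?_
    rw [zero_add, Polynomial.degree_prod]
    simp only [Polynomial.degree_X_sub_C, Finset.sum_const, Finset.card_erase_of_mem,
      Finset.mem_univ, Finset.card_univ, nsmul_eq_mul, mul_one]
    exact_mod_cast Nat.sub_lt (Fintype.card_pos_iff.2 ⟨j⟩) one_pos
  have hzero : N = 0 := by
    refine Polynomial.eq_zero_of_degree_lt_of_eval_finset_eq_zero (Finset.univ.image p) ?_ ?_
    · rwa [Finset.card_image_of_injective _ hp]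
    · intro y hy
      obtain ⟨i, -, rfl⟩ := Finset.mem_image.1 hy
      have : N.eval (p i) = (∏ l, (p i - r l)) * ∑ j, 1 / (p i - r j) * c j := by
        rw [hN, Polynomial.eval_finsetSum, Finset.mul_sum]
        refine Finset.sum_congr rfl fun j _ => ?_
        rw [← Finset.mul_prod_erase _ _ (Finset.mem_univ j)]
        have := sub_ne_zero.2 (hpr i j)
        simp only [Polynomial.eval_mul, Polynomial.eval_C, Polynomial.eval_prod,
          Polynomial.eval_sub, Polynomial.eval_X]
        field_simp
      rw [this, hc, mul_zero]
  funext j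
  have h : N.eval (r j) = c j * ∏ l ∈ Finset.univ.erase j, (r j - r l) := by
    rw [hN, Polynomial.eval_finsetSum, Finset.sum_eq_single j]
    · simp [Polynomial.eval_prod]
    · intro b _ hb
      rw [Polynomial.eval_mul, Polynomial.eval_prod,
        Finset.prod_eq_zero (Finset.mem_erase.2 ⟨hb.symm, Finset.mem_univ j⟩) (by simp), mul_zero]
    · simp
  rw [hzero, Polynomial.eval_zero] at h
  refine (mul_eq_zero.1 h.symm).resolve_right (Finset.prod_ne_zero_iff.2 fun l hl => ?_)
  exact sub_ne_zero.2 fun e => Finset.ne_of_mem_erase hl (hr e).symm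

theorem exists_cauchy_mulVec_eq {p : κ → k} {r : ν → k} (hp : Function.Injective p)
    (hr : Function.Injective r) (hpr : ∀ i j, p i ≠ r j) (hcard : Fintype.card ν = Fintype.card κ)
    (b : κ → k) : ∃ u : ν → k, ∀ i, ∑ j, 1 / (p i - r j) * u j = b i := by
  have hinj : Function.Injective (Matrix.mulVecLin (Matrix.of fun i j => 1 / (p i - r j))) := by
    refine (injective_iff_map_eq_zero _).2 fun c hc => cauchy_ker_eq_zero hp hr hpr hcard fun i => ?_
    exact congrFun hc i
  obtain ⟨u, hu⟩ := (LinearMap.injective_iff_surjective_of_finrank_eq_finrank (by simpa)).1 hinj b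
  exact ⟨u, fun i => congrFun hu i⟩

/-- The transpose of a Cauchy matrix is, up to a global sign, the Cauchy matrix with the two
families of nodes exchanged. -/
theorem exists_cauchy_vecMul_eq {p : κ → k} {r : ν → k} (hp : Function.Injective p)
    (hr : Function.Injective r) (hpr : ∀ i j, p i ≠ r j) (hcard : Fintype.card ν = Fintype.card κ)
    (b : ν → k) : ∃ w : κ → k, ∀ j, ∑ i, w i * (1 / (p i - r j)) = b j := by
  obtain ⟨u, hu⟩ := exists_cauchy_mulVec_eq hr hp (fun j i => (hpr i j).symm) hcard.symm (-b)
  refine ⟨u, fun j => ?_⟩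
  rw [← neg_inj, ← Pi.neg_apply b, ← hu j, ← Finset.sum_neg_distrib]
  refine Finset.sum_congr rfl fun i _ => ?_
  rw [← neg_sub (r j) (p i), one_div_neg_eq_neg_one_div]
  ring

end Cauchy

/-! ### The nodes of the Cauchy matrix -/

theorem infinite_primes_gt (n : ℕ) : {p : ℕ | p.Prime ∧ n + 1 < p}.Infinite := by
  refine Set.infinite_of_not_bddAbove fun ⟨b, hb⟩ => ?_
  obtain ⟨p, hp, hpp⟩ := Nat.exists_infinite_primes (b + n + 2)
  have := hb ⟨hpp, by omega⟩
  omega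

/-- Together with `lt_q` this is all that is needed of the nodes: they are distinct and avoid the
column nodes `1, …, n`. -/
theorem q_injective (n : ℕ) : Function.Injective (q n) := by
  have hlt : ∀ i, n + 1 < q n (i + 1) := fun i =>
    (Nat.nth_mem_of_infinite (infinite_primes_gt n) i).2
  rintro (_ | i) (_ | j) h
  · rfl
  · exact absurd h (hlt j).ne
  · exact absurd h (hlt i).ne'
  · exact congrArg _ (Nat.nth_injective (infinite_primes_gt n) h)

theorem lt_q (n i : ℕ) : n < q n i := by
  rcases i with _ | i
  · exact Nat.lt_succ_self n
  · exact (Nat.lt_succ_self n).trans (Nat.nth_mem_of_infinite (infinite_primes_gt n) i).2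

theorem a_pos {n i j : ℕ} (hj : j ≤ n) : 0 < a n i j := by
  have : (j : ℚ) < q n i := by exact_mod_cast hj.trans_lt (lt_q n i)
  exact one_div_pos.2 (sub_pos.2 this)

theorem cast_a (n i j : ℕ) : ((a n i j : ℚ) : ℂ) = 1 / ((q n i : ℂ) - (j : ℂ)) := by
  simp [a]

section Nodes

variable {κ : Type*} [Fintype κ] {n : ℕ} {ρ : κ → ℕ}

theorem node_ne (n i : ℕ) (j : Fin n) : (q n i : ℂ) ≠ ((j.val + 1 : ℕ) : ℂ) := by
  have := lt_q n i
  exact_mod_cast (show q n i ≠ j.val + 1 by omega)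

/-- The rows of `a` with distinct indices `ρ`, restricted to an equal number of columns, can be
combined to any vector. -/
theorem exists_sum_rows_eq (hρ : Function.Injective ρ) (J : Finset (Fin n))
    (hJ : J.card = Fintype.card κ) (b : Fin n → ℂ) :
    ∃ w : κ → ℂ, ∀ j ∈ J, ∑ i, w i * ((a n (ρ i) (j.val + 1) : ℚ) : ℂ) = b j := by
  obtain ⟨w, hw⟩ := exists_cauchy_vecMul_eq (k := ℂ) (p := fun i => (q n (ρ i) : ℂ))
    (r := fun j : J => ((j.val.val + 1 : ℕ) : ℂ))
    (Nat.cast_injective.comp ((q_injective n).comp hρ))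
    (fun i j h => by
      have h' : i.val.val + 1 = j.val.val + 1 := Nat.cast_injective h
      exact Subtype.ext (Fin.ext (by omega)))
    (fun i j => node_ne n (ρ i) j) (by simpa using hJ) (fun j => b j)
  refine ⟨w, fun j hj => ?_⟩
  simp only [cast_a]
  exact hw ⟨j, hj⟩

/-- The columns of `a`, restricted to an equal number of rows with distinct indices `ρ`, can be
combined to any vector. -/
theorem exists_sum_columns_eq (hρ : Function.Injective ρ) (J : Finset (Fin n))
    (hJ : J.card = Fintype.card κ) (b : κ → ℂ) :
    ∃ u : Fin n → ℂ, ∀ i, ∑ j ∈ J, ((a n (ρ i) (j.val + 1) : ℚ) : ℂ) * u j = b i := by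
  classical
  obtain ⟨u, hu⟩ := exists_cauchy_mulVec_eq (k := ℂ) (p := fun i => (q n (ρ i) : ℂ))
    (r := fun j : J => ((j.val.val + 1 : ℕ) : ℂ))
    (Nat.cast_injective.comp ((q_injective n).comp hρ))
    (fun i j h => by
      have h' : i.val.val + 1 = j.val.val + 1 := Nat.cast_injective h
      exact Subtype.ext (Fin.ext (by omega)))
    (fun i j => node_ne n (ρ i) j) (by simpa using hJ) b
  refine ⟨fun j => if hj : j ∈ J then u ⟨j, hj⟩ else 0, fun i => ?_⟩
  rw [← Finset.sum_coe_sort, ← hu i]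
  exact Finset.sum_congr rfl fun j _ => by simp [cast_a]

end Nodes

end PolyMin

namespace PolyMin

/-! ### Filtered algebras with a perturbation parameter -/

section Filtered

variable {k R Q ν κ : Type*} [CommRing k] [CommRing R] [CommRing Q] [Algebra k R] [Algebra R Q]
  [Algebra k Q] [IsScalarTower k R Q]

variable (R) in
/-- The span of `1` and of the elements `x j`; its powers are the polynomials in `x` of bounded
degree. -/
def affineSpan (x : ν → Q) : Submodule R Q := Submodule.span R (insert 1 (Set.range x))

/-- The polynomials in `x` of degree at most `D`, with leading form divisible by `τ`. -/
def perturbed (τ : R) (x : ν → Q) (D : ℕ) : Submodule R Q :=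
  affineSpan R x ^ (D - 1) + Submodule.span R {algebraMap R Q τ} * affineSpan R x ^ D

variable {τ : R} {x : ν → Q} {e : κ → Q}

theorem one_le_affineSpan : 1 ≤ affineSpan R x :=
  Submodule.one_le.2 (Submodule.subset_span (Set.mem_insert _ _))

theorem mem_affineSpan (j : ν) : x j ∈ affineSpan R x :=
  Submodule.subset_span (Set.mem_insert_of_mem _ ⟨j, rfl⟩)

theorem affineSpan_pow_mono : Monotone fun D => affineSpan R x ^ D :=
  monotone_nat_of_le_succ fun D => by
    rw [pow_succ]
    exact (mul_one _).symm.le.trans (mul_le_mul' le_rfl one_le_affineSpan)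

theorem affineSpan_fg [Finite ν] (D : ℕ) : (affineSpan R x ^ D).FG :=
  Submodule.FG.pow (Submodule.fg_span ((Set.finite_range x).insert 1)) D

theorem mul_mem_affineSpan_pow {y z : Q} {a b : ℕ} (hy : y ∈ affineSpan R x ^ a)
    (hz : z ∈ affineSpan R x ^ b) : y * z ∈ affineSpan R x ^ (a + b) :=
  pow_add (affineSpan R x) a b ▸ Submodule.mul_mem_mul hy hz

theorem pow_mem_affineSpan (j : ν) (D : ℕ) : x j ^ D ∈ affineSpan R x ^ D :=
  Submodule.pow_mem_pow _ (mem_affineSpan j) D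

theorem prod_mem_affineSpan (B : Finset ν) (α : ν → ℕ) :
    ∏ j ∈ B, x j ^ α j ∈ affineSpan R x ^ ∑ j ∈ B, α j := by
  classical
  induction B using Finset.induction_on with
  | empty => simpa using Submodule.one_le.1 (le_refl (1 : Submodule R Q))
  | insert j B hj ih =>
    rw [Finset.prod_insert hj, Finset.sum_insert hj]
    exact mul_mem_affineSpan_pow (pow_mem_affineSpan _ _) ih

theorem aeval_mem_affineSpan {p : MvPolynomial ν k} {D : ℕ} (hp : p.totalDegree ≤ D) :
    MvPolynomial.aeval x p ∈ affineSpan R x ^ D := by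
  rw [MvPolynomial.aeval_def, MvPolynomial.eval₂_eq]
  refine Submodule.sum_mem _ fun s hs => ?_
  rw [← Algebra.smul_def]
  exact Submodule.smul_of_tower_mem _ _ (affineSpan_pow_mono
    ((MvPolynomial.le_totalDegree hs).trans hp) (prod_mem_affineSpan s.support s))

/-- Allows membership statements about the filtration to be checked one monomial at a time. -/
theorem exists_aeval_eq_of_mem_affineSpan_pow {D : ℕ} {z : Q} (hz : z ∈ affineSpan R x ^ D) :
    ∃ p : MvPolynomial ν R, p.totalDegree ≤ D ∧ MvPolynomial.aeval x p = z := by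
  let Y : ℕ → Submodule R Q := fun D =>
    (MvPolynomial.restrictTotalDegree ν R D).map (MvPolynomial.aeval x).toLinearMap
  have h1 : affineSpan R x ≤ Y 1 := by
    refine Submodule.span_le.2 (Set.insert_subset_iff.2 ⟨⟨1, ?_, by simp⟩, ?_⟩)
    · simp [MvPolynomial.mem_restrictTotalDegree]
    · rintro _ ⟨j, rfl⟩
      refine ⟨MvPolynomial.X j, ?_, by simp⟩
      refine (MvPolynomial.mem_restrictTotalDegree _ _ _).2 ?_
      rcases subsingleton_or_nontrivial R
      · rw [Subsingleton.elim (MvPolynomial.X j : MvPolynomial ν R) 0]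
        simp
      · simp
  have h : ∀ D, affineSpan R x ^ D ≤ Y D := fun D => by
    induction D with
    | zero =>
      rw [pow_zero, Submodule.one_le]
      exact ⟨1, by simp [MvPolynomial.mem_restrictTotalDegree], by simp⟩
    | succ D ih =>
      rw [pow_succ]
      refine (mul_le_mul' ih h1).trans (Submodule.mul_le.2 ?_)
      rintro _ ⟨p, hp, rfl⟩ _ ⟨r, hr, rfl⟩
      refine ⟨p * r, ?_, by simp⟩
      have hp' := (MvPolynomial.mem_restrictTotalDegree _ _ _).1 hp
      have hr' := (MvPolynomial.mem_restrictTotalDegree _ _ _).1 hr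
      exact (MvPolynomial.mem_restrictTotalDegree _ _ _).2
        ((MvPolynomial.totalDegree_mul _ _).trans (add_le_add hp' hr'))
  obtain ⟨p, hp, rfl⟩ := h D hz
  exact ⟨p, (MvPolynomial.mem_restrictTotalDegree _ _ _).1 hp, rfl⟩

theorem mem_perturbed_of_lower {D : ℕ} {z : Q} (hz : z ∈ affineSpan R x ^ (D - 1)) :
    z ∈ perturbed τ x D :=
  (le_sup_left : _ ≤ affineSpan R x ^ (D - 1) ⊔ _) hz

theorem mul_mem_perturbed_of_mem {D : ℕ} {z : Q} (hz : z ∈ affineSpan R x ^ D) :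
    algebraMap R Q τ * z ∈ perturbed τ x D :=
  (le_sup_right : _ ≤ _ ⊔ Submodule.span R {algebraMap R Q τ} * affineSpan R x ^ D)
    (Submodule.mul_mem_mul (Submodule.mem_span_singleton_self _) hz)

/-- The bound on `D` is needed because `D - 1` is truncated: for `D = 0` the lower-order part would
not have smaller degree. -/
theorem affineSpan_pow_mul_perturbed (c : ℕ) {D : ℕ} (hD : 1 ≤ D) :
    affineSpan R x ^ c * perturbed τ x D = perturbed τ x (c + D) := by
  rw [perturbed, perturbed, mul_add, ← pow_add, mul_left_comm, ← pow_add, Nat.add_sub_assoc hD]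

theorem mul_mem_perturbed_mul {E : Submodule R Q} {c D : ℕ} (hD : 1 ≤ D) {y z : Q}
    (hy : y ∈ affineSpan R x ^ c) (hz : z ∈ perturbed τ x D * E) :
    y * z ∈ perturbed τ x (c + D) * E := by
  rw [← affineSpan_pow_mul_perturbed c hD, mul_assoc]
  exact Submodule.mul_mem_mul hy hz

/-- If every monomial of degree at most `D` in the generators of a module is of smaller degree up
to a multiple of `τ`, then the generators `x j` satisfy algebraic relations on the module. -/
theorem exists_monic_aeval_mul_eq_zero [Finite ν] [Finite κ] {D : ℕ}
    (h : affineSpan R x ^ (D + 1) * Submodule.span R (Set.range e) ≤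
      perturbed τ x (D + 1) * Submodule.span R (Set.range e)) :
    ∃ s : R, s - 1 ∈ Ideal.span {τ} ∧ ∀ j, ∃ χ : Polynomial R, χ.Monic ∧
      ∀ i, Polynomial.aeval (algebraMap R Q s * x j) χ * e i = 0 := by
  set E := Submodule.span R (Set.range e) with hE
  have hEfg : E.FG := Submodule.fg_span (Set.finite_range e)
  have hN : affineSpan R x ^ (D + 1) * E ≤
      affineSpan R x ^ D * E ⊔ Ideal.span {τ} • (affineSpan R x ^ (D + 1) * E) := by
    refine h.trans ?_
    rw [perturbed, add_mul, Nat.add_sub_cancel, mul_assoc]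
    refine sup_le_sup le_rfl (Submodule.mul_le.2 fun y hy z hz => ?_)
    obtain ⟨r, rfl⟩ := Submodule.mem_span_singleton.1 hy
    rw [smul_mul_assoc, ← Algebra.smul_def]
    exact Submodule.smul_mem _ _ (Submodule.smul_mem_smul (Ideal.mem_span_singleton_self τ) hz)
  -- Nakayama without a local ring: some `s ≡ 1` modulo `τ` carries degree `D + 1` into degree `D`.
  -- Multiplication by `s * x j` is therefore an endomorphism of the finite module `W`, and
  -- Cayley–Hamilton applies.
  obtain ⟨s, hs, hsN⟩ := Submodule.exists_sub_one_mem_and_smul_le_of_fg_of_le_sup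
    ((affineSpan_fg (D + 1)).mul hEfg) le_rfl hN
  refine ⟨s, hs, fun j => ?_⟩
  set W := affineSpan R x ^ D * E with hW
  have hmap : ∀ w ∈ W, LinearMap.mulLeft R (algebraMap R Q s * x j) w ∈ W := fun w hw => by
    rw [LinearMap.mulLeft_apply, mul_assoc, ← Algebra.smul_def]
    refine hsN (Submodule.smul_mem_pointwise_smul _ _ _ ?_)
    rw [pow_succ', mul_assoc]
    exact Submodule.mul_mem_mul (mem_affineSpan j) hw
  have : Module.Finite R W := Module.Finite.iff_fg.2 ((affineSpan_fg D).mul hEfg)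
  obtain ⟨χ, hχ, hχ0⟩ := LinearMap.exists_monic_and_aeval_eq_zero R
    ((LinearMap.mulLeft R (algebraMap R Q s * x j)).restrict hmap)
  refine ⟨χ, hχ, fun i => ?_⟩
  have heW : e i ∈ W := by
    rw [← one_mul (e i)]
    exact Submodule.mul_mem_mul (Submodule.one_le.1 (one_le_pow₀ one_le_affineSpan))
      (Submodule.subset_span ⟨i, rfl⟩)
  -- A polynomial in the restricted multiplication operator acts as multiplication by that
  -- polynomial's value in `Q`.
  have key : ∀ p : Polynomial R, ∀ w : W, ((Polynomial.aeval
      ((LinearMap.mulLeft R (algebraMap R Q s * x j)).restrict hmap) p w : W) : Q) =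
      Polynomial.aeval (algebraMap R Q s * x j) p * w := fun p => by
    induction p using Polynomial.induction_on' with
    | add p r hp hr => intro w; rw [map_add, map_add, LinearMap.add_apply, Submodule.coe_add,
        hp, hr, add_mul]
    | monomial c r =>
      intro w
      rw [Polynomial.aeval_monomial, Polynomial.aeval_monomial]
      induction c generalizing w with
      | zero => simp [Algebra.smul_def]
      | succ c ih =>
        rw [pow_succ, ← mul_assoc, Module.End.mul_apply, ih]
        simp only [LinearMap.restrict_apply, LinearMap.mulLeft_apply]
        ring
  have := key χ ⟨e i, heW⟩
  rw [hχ0] at this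
  simpa using this.symm

end Filtered

end PolyMin

namespace PolyMin

/-! ### Degree reduction by means of the Cauchy minors -/

section Reduction

variable {R Q : Type*} [CommRing R] [CommRing Q] [Algebra ℂ R] [Algebra R Q] [Algebra ℂ Q]
  [IsScalarTower ℂ R Q] {n d : ℕ} {τ : R} {x : Fin n → Q}

section

variable {S : Type} [Fintype S] {ρ : Option S → ℕ} {e : Option S → Q}

/-- Powers of `x j₀` are traded for new variables: while `|B| ≤ |S|`, the constraint relations
express `x j₀ ^ d` through `d`-th powers of variables outside `B`, modulo `perturbed`. Once `|B| =
|S| + 1`, the gradient relations for the columns in `B` determine every `e k`. -/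
theorem pow_mul_prod_mul_mem_perturbed (hρ : Function.Injective ρ) (hd : 2 ≤ d)
    (hS : Fintype.card S ≤ n)
    (hF : ∀ i : S, ∑ j, ((a n (ρ (some i)) (j.val + 1) : ℚ) : ℂ) • x j ^ d ∈ perturbed τ x d)
    (hG : ∀ j, x j ^ (d - 1) * ∑ k, ((a n (ρ k) (j.val + 1) : ℚ) : ℂ) • e k ∈
      perturbed τ x (d - 1) * Submodule.span R (Set.range e))
    (r : ℕ) (B : Finset (Fin n)) {j₀ : Fin n} (hj₀ : j₀ ∈ B)
    (hB : B.card + r = Fintype.card S + 1) (k : Option S) :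
    x j₀ ^ (d * r) * (∏ j ∈ B, x j ^ d) * e k ∈
      perturbed τ x (d * (Fintype.card S + 1)) * Submodule.span R (Set.range e) := by
  classical
  induction r generalizing B with
  | zero =>
    -- This writes `e k` as a combination of the column sums for `j ∈ B`; each of them is absorbed
    -- by the factor `x j ^ (d - 1)` of the product.
    obtain ⟨u, hu⟩ := exists_sum_columns_eq hρ B (by simpa using hB) (Pi.single k 1)
    have hk : e k = ∑ j ∈ B, u j • ∑ i, ((a n (ρ i) (j.val + 1) : ℚ) : ℂ) • e i := by
      simp only [Finset.smul_sum, smul_smul]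
      rw [Finset.sum_comm]
      simp only [← Finset.sum_smul, mul_comm (u _), hu]
      simp [Pi.single_apply]
    rw [hk, mul_zero, pow_zero, one_mul, Finset.mul_sum]
    refine Submodule.sum_mem _ fun j hj => ?_
    rw [mul_smul_comm]
    refine Submodule.smul_of_tower_mem _ _ ?_
    have h1 : ∏ i ∈ B, x i ^ d = (x j ^ 1 * ∏ i ∈ B.erase j, x i ^ d) * x j ^ (d - 1) := by
      rw [← Finset.mul_prod_erase _ _ hj, ← pow_sub_mul_pow (x j) (show 1 ≤ d by omega)]
      ring
    have h2 : d * (Fintype.card S + 1) = (1 + ∑ i ∈ B.erase j, d) + (d - 1) := by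
      rw [Finset.sum_const, Finset.card_erase_of_mem hj, smul_eq_mul,
        show B.card - 1 = Fintype.card S by omega, mul_comm _ d, mul_add]
      omega
    rw [h1, h2, mul_assoc]
    exact mul_mem_perturbed_mul (by omega)
      (mul_mem_affineSpan_pow (pow_mem_affineSpan j 1) (prod_mem_affineSpan _ _)) (hG j)
  | succ r ih =>
    obtain ⟨J, hBJ, hJ⟩ := Finset.exists_superset_card_eq (s := B) (n := Fintype.card S)
      (by omega) (by simpa using hS)
    -- The combination of the constraint rows that equals the unit vector at `j₀` on the columns `J
    -- ⊇ B`; only columns outside `J` remain.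
    obtain ⟨w, hw⟩ := exists_sum_rows_eq (hρ.comp (Option.some_injective S)) J hJ (Pi.single j₀ 1)
    set c : Fin n → ℂ := fun j => ∑ i, w i * ((a n (ρ (some i)) (j.val + 1) : ℚ) : ℂ) with hc
    have hz : ∑ i, w i • ∑ j, ((a n (ρ (some i)) (j.val + 1) : ℚ) : ℂ) • x j ^ d ∈
        perturbed τ x d :=
      Submodule.sum_mem _ fun i _ => Submodule.smul_of_tower_mem _ _ (hF i)
    have hz' : ∑ i, w i • ∑ j, ((a n (ρ (some i)) (j.val + 1) : ℚ) : ℂ) • x j ^ d =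
        x j₀ ^ d + ∑ j ∈ Jᶜ, c j • x j ^ d := by
      simp only [Finset.smul_sum, smul_smul]
      rw [Finset.sum_comm]
      simp only [← Finset.sum_smul]
      rw [← Finset.sum_add_sum_compl J]
      congr 1
      rw [Finset.sum_eq_single_of_mem j₀ (hBJ hj₀)]
      · simpa using congrArg (· • x j₀ ^ d) (hw j₀ (hBJ hj₀))
      · intro j hj hne
        simpa [hne] using congrArg (· • x j ^ d) (hw j hj)
    rw [hz'] at hz
    have hsplit : x j₀ ^ (d * (r + 1)) * (∏ j ∈ B, x j ^ d) * e k =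
        (x j₀ ^ (d * r) * ∏ j ∈ B, x j ^ d) * ((x j₀ ^ d + ∑ j ∈ Jᶜ, c j • x j ^ d) * e k) -
          ∑ j ∈ Jᶜ, c j • (x j₀ ^ (d * r) * (∏ i ∈ insert j B, x i ^ d) * e k) := by
      have : ∀ j ∈ Jᶜ, c j • (x j₀ ^ (d * r) * (∏ i ∈ insert j B, x i ^ d) * e k) =
          (x j₀ ^ (d * r) * ∏ i ∈ B, x i ^ d) * (c j • x j ^ d) * e k := fun j hj => by
        rw [Finset.prod_insert fun h => Finset.mem_compl.1 hj (hBJ h), mul_smul_comm,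
          smul_mul_assoc]
        ring_nf
      rw [Finset.sum_congr rfl this, ← Finset.sum_mul, ← Finset.mul_sum]
      ring
    rw [hsplit]
    refine Submodule.sub_mem _ ?_ (Submodule.sum_mem _ fun j hj =>
      Submodule.smul_of_tower_mem _ _ (ih _ (Finset.mem_insert_of_mem hj₀) ?_))
    · have h2 : d * (Fintype.card S + 1) = (d * r + ∑ i ∈ B, d) + d := by
        rw [← hB, Finset.sum_const, smul_eq_mul]
        ring
      rw [h2]
      exact mul_mem_perturbed_mul (by omega)
        (mul_mem_affineSpan_pow (pow_mem_affineSpan _ _) (prod_mem_affineSpan _ _))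
        (Submodule.mul_mem_mul hz (Submodule.subset_span ⟨k, rfl⟩))
    · rw [Finset.card_insert_of_notMem fun h => Finset.mem_compl.1 hj (hBJ h)]
      omega

/-- With `c = d * (|S| + 1)`, a monomial of degree `n * c + 1` has some exponent at least `c` by
pigeonhole, and the reduction for `B = {j}` applies to the factor `x j ^ c`. Monomials of smaller
degree are already of lower order. -/
theorem exists_affineSpan_pow_mul_le_perturbed (hρ : Function.Injective ρ) (hd : 2 ≤ d)
    (hS : Fintype.card S ≤ n)
    (hF : ∀ i : S, ∑ j, ((a n (ρ (some i)) (j.val + 1) : ℚ) : ℂ) • x j ^ d ∈ perturbed τ x d)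
    (hG : ∀ j, x j ^ (d - 1) * ∑ k, ((a n (ρ k) (j.val + 1) : ℚ) : ℂ) • e k ∈
      perturbed τ x (d - 1) * Submodule.span R (Set.range e)) :
    ∃ D, affineSpan R x ^ (D + 1) * Submodule.span R (Set.range e) ≤
      perturbed τ x (D + 1) * Submodule.span R (Set.range e) := by
  classical
  set c := d * (Fintype.card S + 1) with hc
  have hc0 : 1 ≤ c := Nat.mul_pos (by omega) (Nat.succ_pos _)
  refine ⟨n * c, Submodule.mul_le.2 fun z hz w hw => ?_⟩
  obtain ⟨p, hp, rfl⟩ := exists_aeval_eq_of_mem_affineSpan_pow hz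
  rw [MvPolynomial.aeval_def, MvPolynomial.eval₂_eq, Finset.sum_mul]
  refine Submodule.sum_mem _ fun s hs => ?_
  rw [← Algebra.smul_def, smul_mul_assoc]
  refine Submodule.smul_mem _ _ ?_
  have hdeg : ∑ j, s j ≤ n * c + 1 := by
    refine le_trans (le_of_eq ?_) ((MvPolynomial.le_totalDegree hs).trans hp)
    exact (Finsupp.sum_fintype s (fun _ b => b) fun _ => rfl).symm
  have hprod : ∏ j ∈ s.support, x j ^ s j = ∏ j, x j ^ s j :=
    Finsupp.prod_fintype s (fun j b => x j ^ b) fun _ => pow_zero _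
  rw [hprod]
  rcases hdeg.lt_or_eq with hlt | heq
  · refine Submodule.mul_mem_mul (mem_perturbed_of_lower ?_) hw
    exact affineSpan_pow_mono (Nat.lt_succ_iff.1 hlt) (prod_mem_affineSpan _ _)
  · obtain ⟨j, hj⟩ : ∃ j, c ≤ s j := by
      by_contra! hlt
      have : ∑ j, s j ≤ ∑ _j : Fin n, c := Finset.sum_le_sum fun j _ => (hlt j).le
      simp only [Finset.sum_const, Finset.card_univ, Fintype.card_fin, smul_eq_mul] at this
      omega
    induction hw using Submodule.span_induction with
    | zero => rw [mul_zero]; exact Submodule.zero_mem _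
    | add y z _ _ hy hz => rw [mul_add]; exact Submodule.add_mem _ hy hz
    | smul b y _ hy => rw [mul_smul_comm]; exact Submodule.smul_mem _ _ hy
    | mem y hy =>
      obtain ⟨k, rfl⟩ := hy
      have hred := pow_mul_prod_mul_mem_perturbed hρ hd hS hF hG (Fintype.card S) {j}
        (Finset.mem_singleton_self j) (by rw [Finset.card_singleton, add_comm]) k
      rw [Finset.prod_singleton, ← pow_add, ← mul_add_one, ← hc] at hred
      have h1 : ∏ i, x i ^ s i = (x j ^ (s j - c) * ∏ i ∈ Finset.univ.erase j, x i ^ s i) *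
          x j ^ c := by
        rw [← Finset.mul_prod_erase _ _ (Finset.mem_univ j), ← pow_sub_mul_pow (x j) hj]
        ring
      have h2 : n * c + 1 = (s j - c + ∑ i ∈ Finset.univ.erase j, s i) + c := by
        rw [← heq, ← Finset.add_sum_erase _ _ (Finset.mem_univ j)]
        omega
      rw [h1, h2, mul_assoc]
      exact mul_mem_perturbed_mul hc0
        (mul_mem_affineSpan_pow (pow_mem_affineSpan _ _) (prod_mem_affineSpan _ _)) hred

end

end Reduction

end PolyMin

namespace PolyMin

open MvPolynomial

/-! ### Degrees and leading forms of the polynomials of the deformation -/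

theorem totalDegree_pderiv_le {ν A : Type*} [CommSemiring A] (p : MvPolynomial ν A) (j : ν) :
    (pderiv j p).totalDegree ≤ p.totalDegree - 1 := by
  refine Finset.sup_le fun s hs => ?_
  have h : coeff (s + Finsupp.single j 1) p ≠ 0 := fun h => by
    rw [mem_support_iff, coeff_pderiv, h, zero_mul] at hs
    exact hs rfl
  have := le_totalDegree (mem_support_iff.2 h)
  rw [Finsupp.sum_add_index' (fun _ => rfl) (fun _ _ _ => rfl), Finsupp.sum_single_index rfl] at this
  omega

theorem totalDegree_toComplex_le {K : Subfield ℝ} {n : ℕ} (p : MvPolynomial (Fin n) K) :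
    (toComplex p).totalDegree ≤ p.totalDegree :=
  Finset.sup_mono (support_map_subset _ _)

section LeadingForms

variable {R Q ν : Type*} [CommRing R] [CommRing Q] [Algebra ℂ R] [Algebra R Q] [Algebra ℂ Q]
  [IsScalarTower ℂ R Q]

theorem aeval_sub_leading_mem_affineSpan {p : Polynomial ℂ} {D : ℕ} (hp : p.natDegree ≤ D)
    (x : ν → Q) (j : ν) :
    Polynomial.aeval (x j) p - p.coeff D • x j ^ D ∈ affineSpan R x ^ (D - 1) := by
  rw [Polynomial.aeval_eq_sum_range' (Nat.lt_succ_of_le hp), Finset.sum_range_succ,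
    add_sub_cancel_right]
  refine Submodule.sum_mem _ fun i hi => Submodule.smul_of_tower_mem _ _ ?_
  exact affineSpan_pow_mono (Nat.le_sub_one_of_lt (Finset.mem_range.1 hi)) (pow_mem_affineSpan j i)

theorem algebraMap_mem_affineSpan_pow (x : ν → Q) (c : ℂ) (D : ℕ) :
    algebraMap ℂ Q c ∈ affineSpan R x ^ D := by
  rw [Algebra.algebraMap_eq_smul_one]
  exact Submodule.smul_of_tower_mem _ _ (Submodule.one_le.1 (one_le_pow₀ one_le_affineSpan))

variable {n d : ℕ}

theorem coeff_T_self (d : ℕ) :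
    (Polynomial.Chebyshev.T ℂ (d : ℤ)).coeff d = 2 ^ (d - 1) := by
  have h := Polynomial.Chebyshev.leadingCoeff_T ℂ (d : ℤ)
  rwa [Polynomial.leadingCoeff, Polynomial.Chebyshev.natDegree_T, Int.natAbs_natCast] at h

theorem natDegree_T_le (d : ℕ) : (Polynomial.Chebyshev.T ℂ (d : ℤ)).natDegree ≤ d := by
  rw [Polynomial.Chebyshev.natDegree_T, Int.natAbs_natCast]

theorem aeval_chebVar (x : Fin n → Q) (j : Fin n) :
    aeval x (chebVar d j) = Polynomial.aeval (x j) (Polynomial.Chebyshev.T ℂ (d : ℤ)) := by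
  rw [chebVar, ← Polynomial.aeval_algHom_apply, aeval_X]

theorem aeval_fTilde_sub_mem {m : ℕ} (x : Fin n → Q) (i : Fin m) :
    aeval x (fTilde n d i) - (2 ^ (d - 1) : ℂ) •
      ∑ j : Fin n, ((a n (i.val + 1) (j.val + 1) : ℚ) : ℂ) • x j ^ d ∈
        affineSpan R x ^ (d - 1) := by
  have h : aeval x (fTilde n d i) - (2 ^ (d - 1) : ℂ) •
      ∑ j : Fin n, ((a n (i.val + 1) (j.val + 1) : ℚ) : ℂ) • x j ^ d =
      algebraMap ℂ Q ((a n (i.val + 1) 0 : ℚ) : ℂ) +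
        ∑ j : Fin n, ((a n (i.val + 1) (j.val + 1) : ℚ) : ℂ) •
          ((Polynomial.aeval (x j) (Polynomial.Chebyshev.T ℂ (d : ℤ)) -
            (Polynomial.Chebyshev.T ℂ (d : ℤ)).coeff d • x j ^ d) + algebraMap ℂ Q 1) := by
    simp only [fTilde, map_add, map_sum, map_smul, map_one, aeval_chebVar, ← algebraMap_eq,
      AlgHom.commutes, ← Algebra.smul_def, coeff_T_self, Finset.smul_sum, smul_add, smul_sub,
      Finset.sum_add_distrib, Finset.sum_sub_distrib, smul_comm (2 ^ (d - 1) : ℂ)]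
    ring
  rw [h]
  refine add_mem (algebraMap_mem_affineSpan_pow _ _ _) (Submodule.sum_mem _ fun j _ =>
    Submodule.smul_of_tower_mem _ _ (add_mem ?_ (algebraMap_mem_affineSpan_pow _ _ _)))
  exact aeval_sub_leading_mem_affineSpan (natDegree_T_le d) x j

theorem pderiv_chebVar (i j : Fin n) : pderiv j (chebVar d i) =
    if i = j then Polynomial.aeval (X j)
      (Polynomial.derivative (Polynomial.Chebyshev.T ℂ (d : ℤ))) else 0 := by
  rw [chebVar, Derivation.map_aeval, pderiv_X, smul_eq_mul]
  split_ifs with h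
  · subst h; simp
  · simp [h]

theorem pderiv_gTilde (n d : ℕ) (j : Fin n) : pderiv j (gTilde n d) =
    C ((a n 0 (j.val + 1) : ℚ) : ℂ) * Polynomial.aeval (X j)
      (Polynomial.derivative (Polynomial.Chebyshev.T ℂ (d : ℤ))) := by
  simp [gTilde, pderiv_chebVar]

theorem pderiv_fTilde (n d : ℕ) {m : ℕ} (i : Fin m) (j : Fin n) : pderiv j (fTilde n d i) =
    C ((a n (i.val + 1) (j.val + 1) : ℚ) : ℂ) * Polynomial.aeval (X j)
      (Polynomial.derivative (Polynomial.Chebyshev.T ℂ (d : ℤ))) := by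
  simp [fTilde, pderiv_chebVar]

theorem aeval_derivative_T_sub_mem (hd : 2 ≤ d) (x : Fin n → Q) (j : Fin n) (c : ℂ) :
    aeval x (C c * Polynomial.aeval (X j : MvPolynomial (Fin n) ℂ)
      (Polynomial.derivative (Polynomial.Chebyshev.T ℂ (d : ℤ)))) -
      (2 ^ (d - 1) * d : ℂ) • c • x j ^ (d - 1) ∈ affineSpan R x ^ (d - 1 - 1) := by
  have hdeg : (Polynomial.derivative (Polynomial.Chebyshev.T ℂ (d : ℤ))).natDegree ≤ d - 1 :=
    (Polynomial.natDegree_derivative_le _).trans (Nat.sub_le_sub_right (natDegree_T_le d) 1)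
  have hcoeff : (Polynomial.derivative (Polynomial.Chebyshev.T ℂ (d : ℤ))).coeff (d - 1) =
      2 ^ (d - 1) * d := by
    rw [Polynomial.coeff_derivative, Nat.sub_add_cancel (by omega), coeff_T_self,
      Nat.cast_sub (by omega)]
    simp
  have h := Submodule.smul_of_tower_mem (affineSpan R x ^ (d - 1 - 1)) c
    (aeval_sub_leading_mem_affineSpan hdeg x j)
  rw [hcoeff] at h
  rw [map_mul, ← algebraMap_eq, AlgHom.commutes, ← Algebra.smul_def,
    ← Polynomial.aeval_algHom_apply, aeval_X, smul_comm _ c, ← smul_sub]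
  exact h

end LeadingForms

/-! ### Algebraic relations on `V̂_{S,σ}` -/

section Relations

variable {R Q : Type*} [CommRing R] [CommRing Q] [Algebra ℂ R] [Algebra R Q] [Algebra ℂ Q]
  [IsScalarTower ℂ R Q] {n d : ℕ} {τ : R} {x : Fin n → Q}

theorem smul_mem_cancel {W : Submodule R Q} {c : ℂ} (hc : c ≠ 0) {y : Q} (h : c • y ∈ W) : y ∈ W := by
  have := Submodule.smul_of_tower_mem W c⁻¹ h
  rwa [smul_smul, inv_mul_cancel₀ hc, one_smul] at this

/-- Multiplied by `ε = ε⁻¹`, the equation says that `f̃_i` is `τ` times an element of degree at most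
`d`. Removing the lower terms of `f̃_i` leaves its leading form. -/
theorem leadingForm_mem_perturbed {m : ℕ} (i : Fin m) (ε : ℤˣ)
    {φ : MvPolynomial (Fin n) ℂ} (hφ : φ.totalDegree ≤ d)
    (h : algebraMap R Q τ * aeval x φ +
      algebraMap ℂ Q ((ε : ℤ) : ℂ) * (1 - algebraMap R Q τ) * aeval x (fTilde n d i) = 0) :
    ∑ j : Fin n, ((a n (i.val + 1) (j.val + 1) : ℚ) : ℂ) • x j ^ d ∈ perturbed τ x d := by
  have hlow := aeval_fTilde_sub_mem (R := R) (d := d) x i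
  have hlead : (2 ^ (d - 1) : ℂ) •
      ∑ j : Fin n, ((a n (i.val + 1) (j.val + 1) : ℚ) : ℂ) • x j ^ d ∈ affineSpan R x ^ d :=
    Submodule.smul_of_tower_mem _ _ (Submodule.sum_mem _ fun j _ =>
      Submodule.smul_of_tower_mem _ _ (pow_mem_affineSpan j d))
  have hmem : aeval x (fTilde n d i) ∈ affineSpan R x ^ d := by
    have := add_mem (affineSpan_pow_mono (Nat.sub_le d 1) hlow) hlead
    rwa [sub_add_cancel] at this
  have hε : algebraMap ℂ Q ((ε : ℤ) : ℂ) * algebraMap ℂ Q ((ε : ℤ) : ℂ) = 1 := by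
    rw [← map_mul, ← Int.cast_mul, ← Units.val_mul, Int.units_mul_self]
    simp
  refine smul_mem_cancel (c := 2 ^ (d - 1)) (pow_ne_zero _ two_ne_zero) ?_
  have heq : (2 ^ (d - 1) : ℂ) •
      ∑ j : Fin n, ((a n (i.val + 1) (j.val + 1) : ℚ) : ℂ) • x j ^ d =
      algebraMap R Q τ * (aeval x (fTilde n d i) - ((ε : ℤ) : ℂ) • aeval x φ) -
      (aeval x (fTilde n d i) - (2 ^ (d - 1) : ℂ) •
        ∑ j : Fin n, ((a n (i.val + 1) (j.val + 1) : ℚ) : ℂ) • x j ^ d) := by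
    rw [Algebra.smul_def ((ε : ℤ) : ℂ)]
    linear_combination algebraMap ℂ Q ((ε : ℤ) : ℂ) * h -
      (1 - algebraMap R Q τ) * aeval x (fTilde n d i) * hε
  rw [heq]
  exact sub_mem (mul_mem_perturbed_of_mem (sub_mem hmem
    (Submodule.smul_of_tower_mem _ _ (aeval_mem_affineSpan hφ)))) (mem_perturbed_of_lower hlow)

/-- Here `A k` stands for a partial derivative at `τ = 0`, with leading term `b * c k * y`.
Replacing it by that term costs only lower order, and the right-hand side carries the factor `τ`. -/
theorem gradient_leadingForm_mem_perturbed {κ : Type*} [Fintype κ] {e A B : κ → Q} {c : κ → ℂ}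
    {y : Q} {b : ℂ} (hb : b ≠ 0) {D : ℕ}
    (hA : ∀ k, A k - b • c k • y ∈ affineSpan R x ^ (D - 1)) (hB : ∀ k, B k ∈ affineSpan R x ^ D)
    (h : ∑ k, A k * e k = algebraMap R Q τ * ∑ k, B k * e k) :
    y * ∑ k, c k • e k ∈ perturbed τ x D * Submodule.span R (Set.range e) := by
  refine smul_mem_cancel hb ?_
  have heq : b • (y * ∑ k, c k • e k) = ∑ k, (algebraMap R Q τ * B k) * e k -
      ∑ k, (A k - b • c k • y) * e k := by
    simp only [mul_assoc]
    rw [← Finset.mul_sum, ← h, ← Finset.sum_sub_distrib, Finset.mul_sum, Finset.smul_sum]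
    refine Finset.sum_congr rfl fun k _ => ?_
    simp only [Algebra.smul_def]
    ring
  rw [heq]
  refine sub_mem (Submodule.sum_mem _ fun k _ => ?_) (Submodule.sum_mem _ fun k _ => ?_)
  · exact Submodule.mul_mem_mul (mul_mem_perturbed_of_mem (hB k)) (Submodule.subset_span ⟨k, rfl⟩)
  · exact Submodule.mul_mem_mul (mem_perturbed_of_lower (hA k)) (Submodule.subset_span ⟨k, rfl⟩)

end Relations

end PolyMin

namespace PolyMin

open MvPolynomial

/-! ### Algebraicity of the coordinates over `ℂ(t)` -/

section Finiteness

variable {K : Subfield ℝ} {n m d : ℕ} {f : Fin m → MvPolynomial (Fin n) K}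
  {g : MvPolynomial (Fin n) K} {S : Finset (Fin m)} {σ : S → ℤˣ}

theorem pi_aeval_apply {A ν : Type*} (x : ν → A → ℂ) (p : MvPolynomial ν ℂ) (P : A) :
    aeval x p P = eval (fun j => x j P) p := by
  have h := MvPolynomial.comp_aeval_apply (f := x) (Pi.evalAlgHom ℂ (fun _ : A => ℂ) P) p
  rw [← MvPolynomial.coe_aeval_eq_eval]
  exact h

theorem eval_pderiv_F (i : Fin m) (ε : ℤˣ) (t : ℂ) (y : Fin n → ℂ) (j : Fin n) :
    eval y (pderiv j (F d f i ε t)) = t * eval y (pderiv j (toComplex (f i))) +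
      ((ε : ℤ) : ℂ) * (1 - t) * eval y (pderiv j (fTilde n d i)) := by
  rw [F, map_add, pderiv_C_mul, pderiv_C_mul, map_add, map_mul, map_mul, eval_C, eval_C]

theorem eval_pderiv_G (t : ℂ) (y : Fin n → ℂ) (j : Fin n) :
    eval y (pderiv j (G d g t)) = t * eval y (pderiv j (toComplex g)) +
      (1 - t) * eval y (pderiv j (gTilde n d)) := by
  rw [G, map_add, pderiv_C_mul, pderiv_C_mul, map_add, map_mul, map_mul, eval_C, eval_C]

/-- On `V̂_{S,σ}` each coordinate `x j` is algebraic over `ℂ(t)`. -/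
theorem exists_relation_hatV (hd : 2 ≤ d) (hf : ∀ i, (f i).totalDegree ≤ d)
    (hg : g.totalDegree ≤ d) (hS : S.card ≤ n) (j : Fin n) :
    ∃ Φ : Polynomial (Polynomial ℂ), Φ ≠ 0 ∧ ∀ P ∈ hatV d f g S σ,
      (Φ.map (Polynomial.evalRingHom P.t)).eval (P.x j) = 0 := by
  let A := hatV d f g S σ
  -- The ring `Q` consists of all functions on the set `V̂`, with the polynomial variable acting as
  -- the coordinate `t`; no coordinate ring is needed.
  let _ : Algebra (Polynomial ℂ) (A → ℂ) :=
    (Polynomial.aeval (fun P : A => P.1.t)).toRingHom.toAlgebra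
  have hmapX : algebraMap (Polynomial ℂ) (A → ℂ) Polynomial.X = fun P : A => P.1.t :=
    Polynomial.aeval_X _
  have : IsScalarTower ℂ (Polynomial ℂ) (A → ℂ) := IsScalarTower.of_algebraMap_eq fun c =>
    (AlgHom.commutes (Polynomial.aeval (fun P : A => P.1.t)) c).symm
  let x : Fin n → A → ℂ := fun j P => P.1.x j
  -- The factor `-σ_i` turns the gradient equation at `t = 0` into `∑ e_k ∇p₀_k = 0`, whose leading
  -- coefficients are entries of `a` without signs.
  let e : Option S → A → ℂ := fun k =>
    Option.elim k (fun P => P.1.lam.rep none) fun i P => -((σ i : ℤ) : ℂ) * P.1.lam.rep (some i)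
  let ρ : Option S → ℕ := fun k => Option.elim k 0 fun i => i.val.val + 1
  have hρ : Function.Injective ρ := by
    rintro (_ | i) (_ | j) h
    · rfl
    · exact absurd h (Nat.succ_ne_zero _).symm
    · exact absurd h (Nat.succ_ne_zero _)
    · exact congrArg some (Subtype.ext (Fin.ext (Nat.succ_injective h)))
  have hF : ∀ i : S, ∑ j : Fin n, ((a n (ρ (some i)) (j.val + 1) : ℚ) : ℂ) • x j ^ d ∈
      perturbed (Polynomial.X : Polynomial ℂ) x d := fun i => by
    refine leadingForm_mem_perturbed i.val (σ i)
      ((totalDegree_toComplex_le (f i)).trans (hf i)) (funext fun P => ?_)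
    have := P.2.1 i
    rw [hmapX]
    simp only [F, map_add, map_mul, eval_C] at this
    simp only [Pi.add_apply, Pi.mul_apply, Pi.sub_apply, Pi.one_apply, Pi.zero_apply,
      pi_aeval_apply, Pi.algebraMap_apply, Algebra.algebraMap_self, RingHom.id_apply]
    exact this
  have hsq : ∀ i : S, ((σ i : ℤ) : ℂ) * ((σ i : ℤ) : ℂ) = 1 := fun i => by
    rw [← Int.cast_mul, ← Units.val_mul, Int.units_mul_self]
    simp
  have hG : ∀ j, x j ^ (d - 1) * ∑ k, ((a n (ρ k) (j.val + 1) : ℚ) : ℂ) • e k ∈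
      perturbed (Polynomial.X : Polynomial ℂ) x (d - 1) *
        Submodule.span (Polynomial ℂ) (Set.range e) := fun j => by
    let p : Option S → MvPolynomial (Fin n) ℂ := fun k => Option.elim k (toComplex g)
      fun i => C ((σ i : ℤ) : ℂ) * toComplex (f i)
    let p₀ : Option S → MvPolynomial (Fin n) ℂ := fun k => Option.elim k (gTilde n d)
      fun i => fTilde n d i.val
    have hp : ∀ k, (p k).totalDegree ≤ d := by
      rintro (_ | i)
      · exact (totalDegree_toComplex_le g).trans hg
      · refine (totalDegree_mul _ _).trans ?_
        rw [totalDegree_C, zero_add]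
        exact (totalDegree_toComplex_le (f i)).trans (hf i)
    have hp₀ : ∀ k, pderiv j (p₀ k) = C ((a n (ρ k) (j.val + 1) : ℚ) : ℂ) *
        Polynomial.aeval (X j) (Polynomial.derivative (Polynomial.Chebyshev.T ℂ (d : ℤ))) := by
      rintro (_ | i)
      · exact pderiv_gTilde n d j
      · exact pderiv_fTilde n d i.val j
    have hA : ∀ k, aeval x (pderiv j (p₀ k)) - (2 ^ (d - 1) * d : ℂ) •
        ((a n (ρ k) (j.val + 1) : ℚ) : ℂ) • x j ^ (d - 1) ∈
          affineSpan (Polynomial ℂ) x ^ (d - 1 - 1) := fun k => by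
      rw [hp₀]
      exact aeval_derivative_T_sub_mem hd x j _
    have hlead : ∀ k, aeval x (pderiv j (p₀ k)) ∈ affineSpan (Polynomial ℂ) x ^ (d - 1) :=
      fun k => by
        have := add_mem (affineSpan_pow_mono (Nat.sub_le _ 1) (hA k))
          (Submodule.smul_of_tower_mem _ (2 ^ (d - 1) * d : ℂ) (Submodule.smul_of_tower_mem _
            ((a n (ρ k) (j.val + 1) : ℚ) : ℂ) (pow_mem_affineSpan j (d - 1))))
        rwa [sub_add_cancel] at this
    refine gradient_leadingForm_mem_perturbed (b := 2 ^ (d - 1) * d)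
      (mul_ne_zero (pow_ne_zero _ two_ne_zero) (Nat.cast_ne_zero.2 (by omega))) hA
      (B := fun k => aeval x (pderiv j (p₀ k)) - aeval x (pderiv j (p k))) (fun k => ?_)
      (funext fun P => ?_)
    · exact sub_mem (hlead k) (aeval_mem_affineSpan ((totalDegree_pderiv_le _ _).trans
        (Nat.sub_le_sub_right (hp k) 1)))
    · have := P.2.2 j
      rw [hmapX]
      simp only [eval_pderiv_F, eval_pderiv_G] at this
      have hx : (fun j => x j P) = P.1.x := rfl
      simp only [Fintype.sum_option, Pi.add_apply, Pi.mul_apply, Pi.sub_apply, Finset.sum_apply,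
        pi_aeval_apply, p, p₀, e, Option.elim_none, Option.elim_some, pderiv_C_mul, map_mul,
        eval_C, hx]
      have hterm : ∀ i : S, P.1.lam.rep (some i) * (P.1.t * eval P.1.x (pderiv j (toComplex (f i))) +
          ((σ i : ℤ) : ℂ) * (1 - P.1.t) * eval P.1.x (pderiv j (fTilde n d i.val))) =
          P.1.t * ((eval P.1.x (pderiv j (fTilde n d i.val)) -
            ((σ i : ℤ) : ℂ) * eval P.1.x (pderiv j (toComplex (f i)))) *
              (-((σ i : ℤ) : ℂ) * P.1.lam.rep (some i))) -
          eval P.1.x (pderiv j (fTilde n d i.val)) *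
            (-((σ i : ℤ) : ℂ) * P.1.lam.rep (some i)) := fun i => by
        linear_combination (-P.1.lam.rep (some i) * P.1.t *
          eval P.1.x (pderiv j (toComplex (f i)))) * hsq i
      rw [Finset.sum_congr rfl fun i _ => hterm i, Finset.sum_sub_distrib, ← Finset.mul_sum] at this
      linear_combination this
  obtain ⟨D, hD⟩ := exists_affineSpan_pow_mul_le_perturbed hρ hd (by simpa using hS) hF hG
  obtain ⟨s, hs, hχ⟩ := exists_monic_aeval_mul_eq_zero hD
  obtain ⟨χ, hmonic, hχ⟩ := hχ j
  -- Since `s ≡ 1` modulo `t`, its value at `0` is `1`; hence substituting `s * y` into the monic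
  -- `χ` gives a nonzero polynomial.
  have hs0 : s ≠ 0 := by
    rintro rfl
    obtain ⟨r, hr⟩ := Ideal.mem_span_singleton.1 hs
    simpa using congrArg (Polynomial.eval 0) hr
  refine ⟨χ.comp (Polynomial.C s * Polynomial.X), ?_, fun P hP => ?_⟩
  · intro h
    rw [Polynomial.comp_eq_zero_iff] at h
    rcases h with h | ⟨-, h⟩
    · exact hmonic.ne_zero h
    · have := congrArg (fun p => Polynomial.coeff p 1) h
      simp [hs0] at this
  · have hk : ∃ k, e k ⟨P, hP⟩ ≠ 0 := by
      by_contra! h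
      refine P.lam.rep_nonzero (funext fun k => ?_)
      rcases k with _ | i
      · exact h none
      · exact (mul_eq_zero.1 (h (some i))).resolve_left
          (neg_ne_zero.2 (left_ne_zero_of_mul_eq_one (hsq i)))
    obtain ⟨k, hk⟩ := hk
    have h := (mul_eq_zero.1 (congrFun (hχ k) ⟨P, hP⟩)).resolve_right hk
    have hcomp : (Pi.evalRingHom (fun _ : A => ℂ) ⟨P, hP⟩).comp
        (algebraMap (Polynomial ℂ) (A → ℂ)) = Polynomial.evalRingHom P.t := by
      refine Polynomial.ringHom_ext (fun c => ?_) ?_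
      · rw [RingHom.comp_apply, ← Polynomial.algebraMap_eq, ← IsScalarTower.algebraMap_apply]
        simp
      · rw [RingHom.comp_apply, hmapX]
        simp
    have h' := Polynomial.hom_eval₂ χ (algebraMap (Polynomial ℂ) (A → ℂ))
      (Pi.evalRingHom (fun _ : A => ℂ) ⟨P, hP⟩) (algebraMap (Polynomial ℂ) (A → ℂ) s * x j)
    rw [hcomp, map_mul, ← RingHom.comp_apply, hcomp] at h'
    rw [Polynomial.eval_map, Polynomial.eval₂_comp, Polynomial.eval₂_mul, Polynomial.eval₂_C,
      Polynomial.eval₂_X]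
    exact h'.symm.trans h

end Finiteness

end PolyMin

namespace PolyMin

open MvPolynomial

/-! ### Finiteness of the fibre over `t = 1` -/

section Finiteness

variable {K : Subfield ℝ} {n m d : ℕ} {f : Fin m → MvPolynomial (Fin n) K}
  {g : MvPolynomial (Fin n) K} {S : Finset (Fin m)} {σ : S → ℤˣ}

/-- The constant `t - c` is prime in `ℂ[t][y]`, so its full power can be split off; what remains has
a coefficient not vanishing at `c`. -/
theorem exists_eq_pow_mul_map_eval_ne_zero {Φ : Polynomial (Polynomial ℂ)} (hΦ : Φ ≠ 0) (c : ℂ) :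
    ∃ (N : ℕ) (Ψ : Polynomial (Polynomial ℂ)),
      Φ = Polynomial.C (Polynomial.X - Polynomial.C c) ^ N * Ψ ∧
        Ψ.map (Polynomial.evalRingHom c) ≠ 0 := by
  have hprime : Prime (Polynomial.C (Polynomial.X - Polynomial.C c)) :=
    Polynomial.prime_C_iff.2 (Polynomial.prime_X_sub_C c)
  obtain ⟨Ψ, hΨ, hndvd⟩ := (FiniteMultiplicity.of_prime_left hprime hΦ).exists_eq_pow_mul_and_not_dvd
  refine ⟨_, Ψ, hΨ, fun h => hndvd ((Polynomial.C_dvd_iff_dvd_coeff _ _).2 fun i => ?_)⟩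
  have := congrArg (fun p => Polynomial.coeff p i) h
  rw [Polynomial.coeff_map, Polynomial.coeff_zero] at this
  exact Polynomial.dvd_iff_isRoot.2 this

theorem isClosed_relation {ι : Type} (Φ : Polynomial (Polynomial ℂ)) (j : Fin n) :
    IsClosed {P : TXL n ι | (Φ.map (Polynomial.evalRingHom P.t)).eval (P.x j) = 0} := by
  have h : ∀ P : TXL n ι, eval P.base (Φ.eval₂
      (Polynomial.aeval (X none : MvPolynomial (Option (Fin n)) ℂ)).toRingHom (X (some j))) =
      (Φ.map (Polynomial.evalRingHom P.t)).eval (P.x j) := fun P => by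
    rw [Polynomial.hom_eval₂, Polynomial.eval_map, eval_X]
    congr 1
    refine Polynomial.ringHom_ext (fun c => ?_) ?_
    · simp [← algebraMap_eq]
    · simp [TXL.base]
  simp only [← h]
  exact isClosed_base_zeros _

theorem finite_image_V (hd : 2 ≤ d) (hf : ∀ i, (f i).totalDegree ≤ d)
    (hg : g.totalDegree ≤ d) (hS : S.card ≤ n) :
    (TXL.x '' (V d f g S σ ∩ {P | P.t = 1})).Finite := by
  choose Φ hΦ0 hΦ using exists_relation_hatV (σ := σ) hd hf hg hS
  choose N Ψ hΨ hΨ0 using fun j => exists_eq_pow_mul_map_eval_ne_zero (hΦ0 j) 1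
  have hfin : (Set.univ.pi fun j =>
      {y : ℂ | ((Ψ j).map (Polynomial.evalRingHom 1)).eval y = 0}).Finite :=
    Set.Finite.pi fun j => Polynomial.finite_setOfPred_isRoot (hΨ0 j)
  refine hfin.subset ?_
  rintro _ ⟨P, ⟨⟨Z, ⟨hZ, hZt⟩, hPZ⟩, hPt⟩, rfl⟩ j -
  have hZm : Maximal (fun Z => IsIrreducible Z ∧ Z ⊆ hatV d f g S σ) Z := hZ
  -- The factorization covers `Z` by two closed sets; irreducibility leaves one, and `{t = 1}` is
  -- excluded by the definition of `V`.
  have hZ' : Z ⊆ {P : TXL n S | P.t = 1} ∪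
      {P : TXL n S | ((Ψ j).map (Polynomial.evalRingHom P.t)).eval (P.x j) = 0} := fun Q hQ => by
    have h := hΦ j Q (hZm.prop.2 hQ)
    rw [hΨ j, Polynomial.map_mul, Polynomial.eval_mul, Polynomial.map_pow, Polynomial.eval_pow,
      Polynomial.map_C, Polynomial.eval_C] at h
    rcases mul_eq_zero.1 h with h | h
    · left
      simpa [sub_eq_zero] using eq_zero_of_pow_eq_zero h
    · exact Or.inr h
  have hclosed : IsClosed {P : TXL n S | P.t = 1} := by
    have := isClosed_base_zeros (n := n) (ι := S) (X none - 1)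
    simpa [TXL.base, sub_eq_zero] using this
  rcases isPreirreducible_iff_isClosed_union_isClosed.1 hZm.prop.1.isPreirreducible _ _ hclosed
    (isClosed_relation (Ψ j) j) hZ' with h | h
  · exact absurd ⟨1, h⟩ hZt
  · have := h hPZ
    rw [Set.mem_ofPred_eq, show P.t = 1 from hPt] at this
    exact this

theorem finite_sampleSet (hd : 2 ≤ d) (hf : ∀ i, (f i).totalDegree ≤ d) (hg : g.totalDegree ≤ d)
    (l : ℕ) : (sampleSet l d f g).Finite :=
  (Set.toFinite _).biUnion fun _ hp => finite_image_V hd hf hg hp.1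

end Finiteness

end PolyMin

namespace PolyMin

open MvPolynomial Topology Filter

/-! ### Compact components of closed sets -/

/-- Other components of `A` may accumulate at `C`, so `L` cannot in general isolate `C` alone. It
isolates a relatively clopen piece of `A` around `C`. -/
theorem exists_compact_of_compact_component {X : Type*} [TopologicalSpace X] [T2Space X]
    [LocallyCompactSpace X] {A C U : Set X} (hA : IsClosed A) (hC : IsConnectedComponentOf C A)
    (hCc : IsCompact C) (hU : IsOpen U) (hCU : C ⊆ U) :
    ∃ L, IsCompact L ∧ L ⊆ U ∧ C ⊆ interior L ∧ L ∩ A ⊆ interior L := by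
  obtain ⟨x, hx, rfl⟩ := hC
  obtain ⟨L₀, hL₀, hCL₀, hL₀U⟩ := exists_compact_between hCc hU hCU
  set K := A ∩ L₀ with hK
  have hKc : IsCompact K := hL₀.inter_left hA
  have : CompactSpace K := isCompact_iff_compactSpace.1 hKc
  have hCK : connectedComponentIn A x ⊆ K := fun y hy =>
    ⟨connectedComponentIn_subset A x hy, interior_subset (hCL₀ hy)⟩
  have hxK : x ∈ K := hCK (mem_connectedComponentIn hx)
  have hcomp : Subtype.val '' connectedComponent (⟨x, hxK⟩ : K) = connectedComponentIn A x := by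
    rw [← connectedComponentIn_eq_image hxK]
    refine (connectedComponentIn_mono x Set.inter_subset_left).antisymm ?_
    exact isPreconnected_connectedComponentIn.subset_connectedComponentIn
      (mem_connectedComponentIn hx) hCK
  -- In the compact Hausdorff space `K` a component is the intersection of the clopen sets around
  -- it; by compactness one of them fits into the interior of `L₀`.
  obtain ⟨⟨Q, hQ, hxQ⟩, hQL₀⟩ : ∃ Q : {s : Set K // IsClopen s ∧ (⟨x, hxK⟩ : K) ∈ s},
      Q.1 ⊆ Subtype.val ⁻¹' interior L₀ := by
    have : Nonempty {s : Set K // IsClopen s ∧ (⟨x, hxK⟩ : K) ∈ s} :=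
      ⟨⟨Set.univ, isClopen_univ, Set.mem_univ _⟩⟩
    refine exists_subset_nhds_of_isCompact (fun Q R => ⟨⟨Q.1 ∩ R.1, Q.2.1.inter R.2.1,
      Q.2.2, R.2.2⟩, Set.inter_subset_left, Set.inter_subset_right⟩)
      (fun Q => Q.2.1.isClosed.isCompact) fun y hy => ?_
    rw [← connectedComponent_eq_iInter_isClopen] at hy
    refine (isOpen_interior.preimage continuous_subtype_val).mem_nhds (hCL₀ ?_)
    rw [← hcomp]
    exact ⟨y, hy, rfl⟩
  have hQ1 : IsCompact (Subtype.val '' Q) := hQ.isClosed.isCompact.image continuous_subtype_val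
  have hQ2 : IsCompact (Subtype.val '' Qᶜ) :=
    hQ.isOpen.isClosed_compl.isCompact.image continuous_subtype_val
  -- Points of `A` in this open set can only belong to `Q`.
  have hO : IsOpen (U ∩ (Subtype.val '' Qᶜ ∪ (A ∩ (interior L₀)ᶜ))ᶜ) :=
    hU.inter (hQ2.isClosed.union (hA.inter isOpen_interior.isClosed_compl)).isOpen_compl
  obtain ⟨L, hL, hQL, hLO⟩ := exists_compact_between hQ1 hO (by
    rintro _ ⟨y, hy, rfl⟩
    refine ⟨hL₀U y.2.2, ?_⟩
    rintro (⟨z, hz, hzy⟩ | h)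
    · exact hz (Subtype.ext hzy ▸ hy)
    · exact h.2 (hQL₀ hy))
  refine ⟨L, hL, fun y hy => (hLO hy).1, ?_, ?_⟩
  · rw [← hcomp]
    exact (Set.image_mono (hQ.connectedComponent_subset hxQ)).trans hQL
  · rintro y ⟨hyL, hyA⟩
    have hy := (hLO hyL).2
    have hyint : y ∈ interior L₀ := by
      by_contra h
      exact hy (Or.inr ⟨hyA, h⟩)
    have hyK : y ∈ K := ⟨hyA, interior_subset hyint⟩
    refine hQL ⟨⟨y, hyK⟩, ?_, rfl⟩
    by_contra h
    exact hy (Or.inl ⟨⟨y, hyK⟩, h, rfl⟩)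

/-! ### First order conditions for polynomial constraints -/

section Gradient

variable {n : ℕ}

/-- The gradient of `p` at `x`. -/
noncomputable def grad (p : MvPolynomial (Fin n) ℝ) (x : Fin n → ℝ) : Fin n → ℝ :=
  fun j => eval x (pderiv j p)

theorem hasDerivAt_eval_line (p : MvPolynomial (Fin n) ℝ) (x v : Fin n → ℝ) :
    HasDerivAt (fun s : ℝ => eval (x + s • v) p) (∑ j, v j * grad p x j) 0 := by
  induction p using MvPolynomial.induction_on with
  | C c => simpa [grad] using hasDerivAt_const (0 : ℝ) c
  | add p r hp hr =>
    have := hp.add hr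
    simpa [grad, mul_add, Finset.sum_add_distrib, Pi.add_def] using this
  | mul_X p i hp =>
    have h1 : HasDerivAt (fun s : ℝ => x i + s * v i) (v i) 0 := by
      simpa using ((hasDerivAt_id (0 : ℝ)).mul_const (v i)).const_add (x i)
    have := hp.mul h1
    simp only [map_mul, eval_X, Pi.add_apply, Pi.smul_apply, smul_eq_mul]
    refine this.congr_deriv ?_
    simp only [grad, pderiv_mul, pderiv_X, map_add, map_mul, eval_X, mul_add,
      Finset.sum_add_distrib, zero_smul, add_zero, zero_mul, Finset.sum_mul]
    congr 1
    · exact Finset.sum_congr rfl fun j _ => by ring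
    · rw [Finset.sum_eq_single i]
      · simp [mul_comm]
      · intro j _ hj
        simp [hj]
      · simp

theorem eventually_pos_of_grad {p : MvPolynomial (Fin n) ℝ} {x v : Fin n → ℝ}
    (h : 0 < ∑ j, v j * grad p x j) :
    ∀ᶠ s : ℝ in 𝓝[>] 0, eval x p < eval (x + s • v) p := by
  have hslope := (hasDerivAt_iff_tendsto_slope.1 (hasDerivAt_eval_line p x v)).mono_left
    (nhdsWithin_mono (0 : ℝ) fun s (hs : 0 < s) => hs.ne')
  filter_upwards [hslope.eventually (lt_mem_nhds h), self_mem_nhdsWithin] with s hs hs0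
  rw [slope_def_field, zero_smul, add_zero, sub_zero] at hs
  exact sub_pos.1 ((div_pos_iff_of_pos_right hs0).1 hs)

/-- At an interior minimizer no direction decreases the objective while increasing all the active
constraints. -/
theorem false_of_descent_direction {κ : Type*} [Finite κ] {L : Set (Fin n → ℝ)} {x v : Fin n → ℝ}
    (hx : x ∈ interior L) {p : MvPolynomial (Fin n) ℝ} {h : κ → MvPolynomial (Fin n) ℝ}
    (hfeas : ∀ c, 0 ≤ eval x (h c))
    (hmin : ∀ y ∈ L, (∀ c, 0 ≤ eval y (h c)) → eval x p ≤ eval y p)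
    (hv : ∀ c, eval x (h c) = 0 → 0 < ∑ j, v j * grad (h c) x j)
    (hp : ∑ j, v j * grad p x j < 0) : False := by
  have hline : Tendsto (fun s : ℝ => x + s • v) (𝓝[>] 0) (𝓝 x) := by
    have : Continuous fun s : ℝ => x + s • v := by fun_prop
    simpa using (this.tendsto 0).mono_left (nhdsWithin_le_nhds (s := Set.Ioi 0))
  have h1 : ∀ᶠ s : ℝ in 𝓝[>] 0, ∀ c, 0 ≤ eval (x + s • v) (h c) := by
    refine eventually_all.2 fun c => ?_
    rcases (hfeas c).eq_or_lt with h0 | h0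
    · filter_upwards [eventually_pos_of_grad (hv c h0.symm)] with s hs
      exact h0.le.trans hs.le
    · have := ((MvPolynomial.continuous_eval (h c)).tendsto x).comp hline
      filter_upwards [this.eventually (lt_mem_nhds h0)] with s hs
      exact hs.le
  have h2 : ∀ᶠ s : ℝ in 𝓝[>] 0, eval x (-p) < eval (x + s • v) (-p) := by
    refine eventually_pos_of_grad ?_
    simpa [grad] using hp
  have h3 : ∀ᶠ s : ℝ in 𝓝[>] 0, x + s • v ∈ L :=
    (hline.eventually (isOpen_interior.mem_nhds hx)).mono fun s hs => interior_subset hs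
  obtain ⟨s, h1, h2, h3⟩ := (h1.and (h2.and h3)).exists
  have := hmin _ h3 h1
  simp only [map_neg] at h2
  linarith

/-- A linearly independent family takes prescribed scalar products with some vector. -/
theorem exists_dotProduct_eq {κ : Type*} {w : κ → Fin n → ℝ} (hw : LinearIndependent ℝ w)
    (b : κ → ℝ) : ∃ v : Fin n → ℝ, ∀ k, ∑ j, v j * w k j = b k := by
  obtain ⟨φ, hφ⟩ := LinearMap.exists_extend ((Finsupp.linearCombination ℝ b).comp hw.repr)
  refine ⟨fun j => φ (Pi.single j 1), fun k => ?_⟩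
  have h := LinearMap.congr_fun hφ ⟨w k, Submodule.subset_span ⟨k, rfl⟩⟩
  have hk : hw.repr ⟨w k, Submodule.subset_span ⟨k, rfl⟩⟩ = Finsupp.single k 1 :=
    hw.repr_eq_single k _ rfl
  simp only [LinearMap.comp_apply, Submodule.subtype_apply, hk,
    Finsupp.linearCombination_single, one_smul] at h
  rw [← h, LinearMap.pi_apply_eq_sum_univ φ (w k)]
  refine Finset.sum_congr rfl fun j _ => ?_
  rw [smul_eq_mul, mul_comm]
  refine congrArg (w k j * ·) (congrArg φ (funext fun i => ?_))
  simp [Pi.single_apply, eq_comm]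

end Gradient

end PolyMin

namespace PolyMin

open MvPolynomial Topology Filter

/-! ### The deformation over the real numbers -/

section Real

/-- `T_{2k} = 2 T_k ^ 2 - 1`. This is where evenness of `d` makes every `f̃_i` positive on `ℝⁿ`. -/
theorem neg_one_le_eval_T {d : ℕ} (hd : Even d) (y : ℝ) :
    -1 ≤ (Polynomial.Chebyshev.T ℝ (d : ℤ)).eval y := by
  obtain ⟨k, rfl⟩ := hd
  rw [show ((k + k : ℕ) : ℤ) = 2 * (k : ℤ) by push_cast; ring, Polynomial.Chebyshev.T_mul,
    Polynomial.Chebyshev.T_two]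
  simp only [Polynomial.eval_comp, Polynomial.eval_sub, Polynomial.eval_mul, Polynomial.eval_pow,
    Polynomial.eval_X, Polynomial.eval_one, Polynomial.eval_ofNat]
  nlinarith [sq_nonneg ((Polynomial.Chebyshev.T ℝ (k : ℤ)).eval y)]

theorem map_aeval_T {n : ℕ} (d : ℕ) (j : Fin n) :
    map (algebraMap ℝ ℂ) (Polynomial.aeval (X j : MvPolynomial (Fin n) ℝ)
      (Polynomial.Chebyshev.T ℝ (d : ℤ))) = chebVar d j := by
  rw [chebVar, ← Polynomial.Chebyshev.map_T (algebraMap ℝ ℂ), Polynomial.aeval_def,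
    Polynomial.hom_eval₂, Polynomial.aeval_def, Polynomial.eval₂_map, map_X]
  congr 1
  ext c
  simp [algebraMap_eq]

theorem exists_real_gTilde (n d : ℕ) :
    ∃ γ : MvPolynomial (Fin n) ℝ, map (algebraMap ℝ ℂ) γ = gTilde n d := by
  refine ⟨∑ j : Fin n, C ((a n 0 (j.val + 1) : ℚ) : ℝ) *
    Polynomial.aeval (X j) (Polynomial.Chebyshev.T ℝ (d : ℤ)), ?_⟩
  simp only [gTilde, map_sum, map_mul, map_aeval_T, map_C]
  simp

theorem exists_real_fTilde (n : ℕ) {d : ℕ} (hd : Even d) {m : ℕ} (i : Fin m) :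
    ∃ φ : MvPolynomial (Fin n) ℝ, map (algebraMap ℝ ℂ) φ = fTilde n d i ∧
      ∀ x, 0 < eval x φ := by
  refine ⟨C ((a n (i.val + 1) 0 : ℚ) : ℝ) + ∑ j : Fin n, C ((a n (i.val + 1) (j.val + 1) : ℚ) : ℝ) *
    (Polynomial.aeval (X j) (Polynomial.Chebyshev.T ℝ (d : ℤ)) + 1), ?_, fun x => ?_⟩
  · simp only [fTilde, map_sum, map_add, map_mul, map_aeval_T, map_C, map_one]
    simp
  · simp only [map_add, map_sum, map_mul, eval_C, map_one]
    have h0 : 0 < ((a n (i.val + 1) 0 : ℚ) : ℝ) := by exact_mod_cast a_pos (Nat.zero_le n)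
    refine add_pos_of_pos_of_nonneg h0 (Finset.sum_nonneg fun j _ => mul_nonneg ?_ ?_)
    · exact_mod_cast (a_pos (show j.val + 1 ≤ n from j.2)).le
    · have h : eval x (Polynomial.aeval (X j) (Polynomial.Chebyshev.T ℝ (d : ℤ))) =
          (Polynomial.Chebyshev.T ℝ (d : ℤ)).eval (x j) := by
        rw [← MvPolynomial.coe_aeval_eq_eval, RingHom.coe_coe, ← Polynomial.aeval_algHom_apply,
          aeval_X, Polynomial.coe_aeval_eq_eval]
      rw [h]
      linarith [neg_one_le_eval_T hd (x j)]

variable {K : Subfield ℝ} {n m : ℕ}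

theorem map_map_eq_toComplex (p : MvPolynomial (Fin n) K) :
    map (algebraMap ℝ ℂ) (map (algebraMap K ℝ) p) = toComplex p := by
  rw [MvPolynomial.map_map]
  rfl

theorem eval_ofReal (x : Fin n → ℝ) (p : MvPolynomial (Fin n) ℝ) :
    eval (fun j => (x j : ℂ)) (map (algebraMap ℝ ℂ) p) = (eval x p : ℂ) := by
  have h := eval₂_comp_left (algebraMap ℝ ℂ) (RingHom.id ℝ) x p
  rw [eval_map, ← RingHom.comp_id (algebraMap ℝ ℂ)]
  exact h.symm

theorem ofReal_grad (x : Fin n → ℝ) (p : MvPolynomial (Fin n) ℝ) (j : Fin n) :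
    eval (fun j => (x j : ℂ)) (pderiv j (map (algebraMap ℝ ℂ) p)) = (grad p x j : ℂ) := by
  rw [pderiv_map, eval_ofReal, grad]

end Real

/-! ### Critical points from minimizers -/

section Critical

variable {K : Subfield ℝ} {n m d l : ℕ} {f : Fin m → MvPolynomial (Fin n) K}
  {g : MvPolynomial (Fin n) K}

/-- A dependent family indexed by `none` and a finite set has a dependent subfamily indexed by
`none` and at most as many further indices as the dimension. -/
theorem exists_subset_not_linearIndependent {S₀ : Finset (Fin m)} {w : Option (Fin m) → Fin n → ℝ}
    (hw : ¬ LinearIndependent ℝ fun k : Option S₀ => w (k.map (↑))) :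
    ∃ S : Finset (Fin m), S ⊆ S₀ ∧ S.card ≤ n ∧
      ¬ LinearIndependent ℝ fun k : Option S => w (k.map (↑)) := by
  by_cases h : S₀.card ≤ n
  · exact ⟨S₀, subset_rfl, h, hw⟩
  · obtain ⟨S, hS, hcard⟩ := Finset.exists_subset_card_eq (not_le.1 h).le
    refine ⟨S, hS, hcard.le, fun hli => ?_⟩
    have := hli.fintype_card_le_finrank
    simp [hcard] at this

/-- A Fritz John condition: if the gradients of `G` and of the active constraints were independent,
some direction would decrease `G` while increasing those constraints. The constraints are written as
`ε F_i^ε ≥ 0`. -/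
theorem exists_mem_hatV_of_minimizer {φ : Fin m → MvPolynomial (Fin n) ℝ}
    {γ : MvPolynomial (Fin n) ℝ} (hφ : ∀ i, map (algebraMap ℝ ℂ) (φ i) = fTilde n d i)
    (hφ0 : ∀ i x, 0 < eval x (φ i)) (hγ : map (algebraMap ℝ ℂ) γ = gTilde n d)
    {t : ℝ} (ht : t < 1) {L : Set (Fin n → ℝ)} {x : Fin n → ℝ} (hx : x ∈ interior L)
    (hfeas : ∀ (i : Fin m) (ε : ℤˣ), (ε = 1 ∨ i.val < l) →
      0 ≤ ((ε : ℤ) : ℝ) * (t * aeval x (f i)) + (1 - t) * eval x (φ i))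
    (hmin : ∀ y ∈ L, (∀ (i : Fin m) (ε : ℤˣ), (ε = 1 ∨ i.val < l) →
      0 ≤ ((ε : ℤ) : ℝ) * (t * aeval y (f i)) + (1 - t) * eval y (φ i)) →
      t * aeval x g + (1 - t) * eval x γ ≤ t * aeval y g + (1 - t) * eval y γ) :
    ∃ p ∈ signedSubsets n m l, ∃ v : {v : Option p.1 → ℂ // v ≠ 0},
      mkPoint ⟨(t : ℂ), fun j => (x j : ℂ), v⟩ ∈ hatV d f g p.1 p.2 := by
  classical
  set Fr : Fin m → ℤˣ → MvPolynomial (Fin n) ℝ := fun i ε =>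
    C t * map (algebraMap K ℝ) (f i) + C (((ε : ℤ) : ℝ) * (1 - t)) * φ i with hFr
  set Gr : MvPolynomial (Fin n) ℝ := C t * map (algebraMap K ℝ) g + C (1 - t) * γ with hGr
  have hFmap : ∀ i ε, map (algebraMap ℝ ℂ) (Fr i ε) = F d f i ε (t : ℂ) := fun i ε => by
    simp [hFr, F, hφ, map_map_eq_toComplex]
  have hGmap : map (algebraMap ℝ ℂ) Gr = G d g (t : ℂ) := by
    simp [hGr, G, hγ, map_map_eq_toComplex]
  have hevalK : ∀ (y : Fin n → ℝ) (p : MvPolynomial (Fin n) K),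
      eval y (map (algebraMap K ℝ) p) = aeval y p := fun y p => by
    rw [eval_map, aeval_def]
  have hFeval : ∀ (y : Fin n → ℝ) (i : Fin m) (ε : ℤˣ), eval y (C ((ε : ℤ) : ℝ) * Fr i ε) =
      ((ε : ℤ) : ℝ) * (t * aeval y (f i)) + (1 - t) * eval y (φ i) := fun y i ε => by
    have hsq : ((ε : ℤ) : ℝ) * ((ε : ℤ) : ℝ) = 1 := by
      rw [← Int.cast_mul, ← Units.val_mul, Int.units_mul_self]
      simp
    simp only [hFr, map_add, map_mul, eval_C, hevalK]
    linear_combination (1 - t) * eval y (φ i) * hsq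
  have hGeval : ∀ y, eval y Gr = t * aeval y g + (1 - t) * eval y γ := fun y => by
    simp only [hGr, map_add, map_mul, eval_C, hevalK]
  set σ : Fin m → ℤˣ := fun i => if i.val < l ∧ eval x (Fr i (-1)) = 0 then -1 else 1 with hσ
  set S₀ : Finset (Fin m) := Finset.univ.filter fun i => eval x (Fr i (σ i)) = 0 with hS₀
  -- `F_i^+` and `F_i^-` cannot both vanish, as their difference is `2 (1 - t) f̃_i > 0`; so each
  -- index has at most one active sign.
  have hactive : ∀ (i : Fin m) (ε : ℤˣ), (ε = 1 ∨ i.val < l) → eval x (Fr i ε) = 0 → ε = σ i := by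
    intro i ε hε h0
    rcases Int.units_eq_one_or ε with rfl | rfl
    · have hne : eval x (Fr i (-1)) ≠ 0 := by
        intro h1
        simp only [hFr, map_add, map_mul, eval_C] at h0 h1
        have := mul_pos (sub_pos.2 ht) (hφ0 i x)
        push_cast at h0 h1
        linarith
      simp [hσ, hne]
    · have hl : i.val < l := hε.resolve_left (by decide)
      simp [hσ, hl, h0]
  set w : Option (Fin m) → Fin n → ℝ := fun k =>
    Option.elim k (grad Gr x) fun i => grad (Fr i (σ i)) x with hw
  have hdep : ¬ LinearIndependent ℝ fun k : Option S₀ => w (k.map (↑)) := by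
    intro hli
    obtain ⟨v, hv⟩ := exists_dotProduct_eq hli
      (fun k => Option.elim k (-1) fun i => ((σ i.val : ℤ) : ℝ))
    refine false_of_descent_direction (κ := {c : Fin m × ℤˣ // c.2 = 1 ∨ c.1.val < l})
      (h := fun c => C ((c.1.2 : ℤ) : ℝ) * Fr c.1.1 c.1.2) (p := Gr) (v := v) hx
      (fun c => ?_) (fun y hy hyf => ?_) (fun c hc => ?_) ?_
    · rw [hFeval]
      exact hfeas _ _ c.2
    · rw [hGeval, hGeval]
      refine hmin y hy fun i ε hε => ?_
      have := hyf ⟨(i, ε), hε⟩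
      rwa [hFeval] at this
    · obtain ⟨⟨i, ε⟩, hε⟩ := c
      have h0 : eval x (Fr i ε) = 0 := by
        rw [map_mul, eval_C] at hc
        refine (mul_eq_zero.1 hc).resolve_left ?_
        exact_mod_cast ε.ne_zero
      obtain rfl := hactive i ε hε h0
      have h1 := hv (some ⟨i, by simpa [hS₀] using h0⟩)
      have h2 : ∀ j, grad (C ((σ i : ℤ) : ℝ) * Fr i (σ i)) x j =
          ((σ i : ℤ) : ℝ) * grad (Fr i (σ i)) x j := fun j => by
        simp [grad]
      have h3 : ∑ j, v j * grad (Fr i (σ i)) x j = ((σ i : ℤ) : ℝ) := h1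
      simp only [h2, mul_left_comm (v _)]
      rw [← Finset.mul_sum, h3, ← Int.cast_mul, ← Units.val_mul, Int.units_mul_self]
      simp
    · have h1 := hv none
      have h3 : ∑ j, v j * grad Gr x j = -1 := h1
      rw [h3]
      norm_num
  obtain ⟨S, hSS₀, hScard, hS⟩ := exists_subset_not_linearIndependent hdep
  obtain ⟨μ, hμ, k₀, hk₀⟩ := Fintype.not_linearIndependent_iff.1 hS
  let v : Option S → ℂ := fun k => Option.elim k (μ none : ℂ) fun i => -(μ (some i) : ℂ)
  have hv : v ≠ 0 := fun h => by
    refine hk₀ ?_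
    have := congrFun h k₀
    rcases k₀ with _ | i
    · simpa [v] using this
    · simpa [v] using this
  refine ⟨⟨S, fun i => σ i⟩, ⟨hScard, fun i hi => ?_⟩, ⟨v, hv⟩, mkPoint_mem_hatV hv ?_ ?_⟩
  · simp [hσ, not_lt.2 hi]
  · intro i
    rw [← hFmap, eval_ofReal]
    have := hSS₀ i.2
    simp only [hS₀, Finset.mem_filter, Finset.mem_univ, true_and] at this
    simp [this]
  · intro j
    have h := congrFun hμ j
    simp only [Fintype.sum_option, Pi.smul_apply, Finset.sum_apply, smul_eq_mul,
      hw, Option.map_none, Option.map_some, Option.elim_none, Option.elim_some,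
      Pi.zero_apply] at h
    rw [← hGmap, ofReal_grad]
    simp only [← hFmap, ofReal_grad, v, Option.elim_none, Option.elim_some, neg_mul,
      Finset.sum_neg_distrib]
    rw [← add_eq_zero_iff_eq_neg]
    exact_mod_cast h

end Critical

end PolyMin

namespace PolyMin

open MvPolynomial Topology Filter

/-! ### Passage to the limit `t → 1` -/

section Limit

variable {K : Subfield ℝ} {n m d l : ℕ} {f : Fin m → MvPolynomial (Fin n) K}
  {g : MvPolynomial (Fin n) K}

theorem continuous_aeval_real (p : MvPolynomial (Fin n) K) :
    Continuous fun x : Fin n → ℝ => aeval x p := by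
  have h : (fun x : Fin n → ℝ => aeval x p) = fun x => eval x (map (algebraMap K ℝ) p) := by
    funext x
    rw [eval_map, aeval_def]
  rw [h]
  exact MvPolynomial.continuous_eval _

theorem isClosed_feasibleSet (l : ℕ) (f : Fin m → MvPolynomial (Fin n) K) :
    IsClosed (feasibleSet l f) := by
  have h : feasibleSet l f = (⋂ i : Fin m, ⋂ _ : i.val < l, {x | aeval x (f i) = 0}) ∩
      ⋂ i : Fin m, ⋂ _ : l ≤ i.val, {x | 0 ≤ aeval x (f i)} := by
    ext x
    simp [feasibleSet]
  rw [h]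
  exact (isClosed_iInter fun i => isClosed_iInter fun _ =>
    isClosed_eq (continuous_aeval_real _) continuous_const).inter
    (isClosed_iInter fun i => isClosed_iInter fun _ =>
      isClosed_le continuous_const (continuous_aeval_real _))

theorem isClosed_minimizerSet {E : Set (Fin n → ℝ)} (hE : IsClosed E) (g : MvPolynomial (Fin n) K)
    (c : ℝ) : IsClosed (minimizerSet E g c) :=
  hE.inter (isClosed_eq (continuous_aeval_real g) continuous_const)

/-- The values of the deformed polynomials converge to those of the original one as `t → 1`. -/
theorem tendsto_deformed {α : Type*} {u : Filter α} {t : α → ℝ} {x : α → Fin n → ℝ}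
    {x₀ : Fin n → ℝ} (ht : Tendsto t u (𝓝 1)) (hx : Tendsto x u (𝓝 x₀)) (c : ℝ)
    (p : MvPolynomial (Fin n) K) (φ : MvPolynomial (Fin n) ℝ) :
    Tendsto (fun k => c * (t k * aeval (x k) p) + (1 - t k) * eval (x k) φ) u
      (𝓝 (c * aeval x₀ p)) := by
  have h1 := ((continuous_aeval_real p).tendsto x₀).comp hx
  have h2 := ((MvPolynomial.continuous_eval φ).tendsto x₀).comp hx
  simpa using ((ht.mul h1).const_mul c).add ((ht.const_sub 1).mul h2)

/-- Near each compact component of the set of minimizers there is a point of the sample set. -/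
theorem exists_mem_sampleSet (hd : Even d) {gmin : ℝ}
    (hgmin : gmin ∈ lowerBounds ((fun x : Fin n → ℝ => aeval x g) '' feasibleSet l f))
    {C U : Set (Fin n → ℝ)}
    (hC : IsConnectedComponentOf C (minimizerSet (feasibleSet l f) g gmin)) (hCc : IsCompact C)
    (hU : IsOpen U) (hCU : C ⊆ U) :
    ∃ z ∈ U, (fun j => (z j : ℂ)) ∈ sampleSet l d f g := by
  choose φ hφ hφ0 using fun i : Fin m => exists_real_fTilde n hd i
  obtain ⟨γ, hγ⟩ := exists_real_gTilde n d
  obtain ⟨L, hL, hLU, hCL, hLA⟩ := exists_compact_of_compact_component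
    (isClosed_minimizerSet (isClosed_feasibleSet l f) g gmin) hC hCc hU hCU
  obtain ⟨c, hc, rfl⟩ := hC
  have hcL : c ∈ L := interior_subset (hCL (mem_connectedComponentIn hc))
  obtain ⟨⟨hc0, hcpos⟩, hcg⟩ := hc
  let t : ℕ → ℝ := fun k => 1 - 1 / ((k : ℝ) + 1)
  have ht0 : ∀ k, 0 ≤ t k := fun k => by
    have : 1 / ((k : ℝ) + 1) ≤ 1 := (div_le_one (by positivity)).2 (by simp)
    simpa [t] using this
  have ht1 : ∀ k, t k < 1 := fun k => sub_lt_self _ (by positivity)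
  have htlim : Tendsto t atTop (𝓝 1) := by
    simpa [t] using tendsto_one_div_add_atTop_nhds_zero_nat (𝕜 := ℝ) |>.const_sub 1
  let E : ℕ → Set (Fin n → ℝ) := fun k => {y | ∀ (i : Fin m) (ε : ℤˣ), (ε = 1 ∨ i.val < l) →
    0 ≤ ((ε : ℤ) : ℝ) * (t k * aeval y (f i)) + (1 - t k) * eval y (φ i)}
  have hEclosed : ∀ k, IsClosed (E k) := fun k => by
    have h : E k = ⋂ (i : Fin m) (ε : ℤˣ) (_ : ε = 1 ∨ i.val < l),
        {y | 0 ≤ ((ε : ℤ) : ℝ) * (t k * aeval y (f i)) + (1 - t k) * eval y (φ i)} := by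
      ext y
      simp [E]
    rw [h]
    refine isClosed_iInter fun i => isClosed_iInter fun ε => isClosed_iInter fun _ =>
      isClosed_le continuous_const ?_
    exact (continuous_const.mul (continuous_const.mul (continuous_aeval_real _))).add
      (continuous_const.mul (MvPolynomial.continuous_eval _))
  -- Positivity of `f̃_i` keeps `c` feasible for every `t k`, so it can be compared with the
  -- minimizers.
  have hcE : ∀ k, c ∈ E k := fun k i ε hε => by
    refine add_nonneg ?_ (mul_nonneg (sub_nonneg.2 (ht1 k).le) (hφ0 i c).le)
    rcases lt_or_ge i.val l with hi | hi
    · simp [hc0 i hi]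
    · obtain rfl := hε.resolve_right (not_lt.2 hi)
      simpa using mul_nonneg (ht0 k) (hcpos i hi)
  have hmin : ∀ k, ∃ x ∈ L ∩ E k, IsMinOn (fun y => t k * aeval y g + (1 - t k) * eval y γ)
      (L ∩ E k) x := fun k => by
    refine (hL.inter_right (hEclosed k)).exists_isMinOn ⟨c, hcL, hcE k⟩ (Continuous.continuousOn ?_)
    exact (continuous_const.mul (continuous_aeval_real _)).add
      (continuous_const.mul (MvPolynomial.continuous_eval _))
  choose x hxLE hxmin using hmin
  -- One ultrafilter replaces the successive extractions of subsequences: for `x k`, for the pair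
  -- `(S, σ)` and for `λ`.
  let u : Ultrafilter ℕ := hyperfilter ℕ
  have hu : (u : Filter ℕ) ≤ atTop := by
    rw [← Nat.cofinite_eq_atTop]
    exact hyperfilter_le_cofinite
  have htu := htlim.mono_left hu
  obtain ⟨x₀, hx₀L, hx₀⟩ := hL.ultrafilter_le_nhds (u.map x)
    (tendsto_principal.2 (Eventually.of_forall fun k => (hxLE k).1) : Tendsto x u (𝓟 L))
  have hxu : Tendsto x u (𝓝 x₀) := hx₀
  have hx₀E : x₀ ∈ feasibleSet l f := by
    have h : ∀ (i : Fin m) (ε : ℤˣ), (ε = 1 ∨ i.val < l) → 0 ≤ ((ε : ℤ) : ℝ) * aeval x₀ (f i) :=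
      fun i ε hε => ge_of_tendsto' (tendsto_deformed htu hxu _ (f i) (φ i))
        fun k => (hxLE k).2 i ε hε
    refine ⟨fun i hi => le_antisymm ?_ ?_, fun i _ => ?_⟩
    · simpa using h i (-1) (Or.inr hi)
    · simpa using h i 1 (Or.inl rfl)
    · simpa using h i 1 (Or.inl rfl)
  have hx₀A : x₀ ∈ minimizerSet (feasibleSet l f) g gmin := by
    refine ⟨hx₀E, le_antisymm ?_ (hgmin ⟨x₀, hx₀E, rfl⟩)⟩
    have h1 := tendsto_deformed htu hxu 1 g γ
    have h2 := tendsto_deformed htu (tendsto_const_nhds (x := c)) 1 g γ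
    have h3 := le_of_tendsto_of_tendsto' h1 h2 fun k => by
      simpa using hxmin k ⟨hcL, hcE k⟩
    rw [one_mul, one_mul] at h3
    exact h3.trans_eq hcg
  have hx₀int : x₀ ∈ interior L := hLA ⟨hx₀L, hx₀A⟩
  have hcrit : ∀ᶠ k in (u : Filter ℕ), ∃ p ∈ signedSubsets n m l,
      ∃ v : {v : Option p.1 → ℂ // v ≠ 0},
        mkPoint ⟨(t k : ℂ), fun j => (x k j : ℂ), v⟩ ∈ hatV d f g p.1 p.2 := by
    filter_upwards [hxu.eventually (isOpen_interior.mem_nhds hx₀int)] with k hk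
    exact exists_mem_hatV_of_minimizer hφ hφ0 hγ (ht1 k) hk (hxLE k).2
      fun y hy hyE => hxmin k ⟨hy, hyE⟩
  obtain ⟨p, hp, hcrit⟩ : ∃ p ∈ signedSubsets n m l, ∀ᶠ k in (u : Filter ℕ),
      ∃ v : {v : Option p.1 → ℂ // v ≠ 0},
        mkPoint ⟨(t k : ℂ), fun j => (x k j : ℂ), v⟩ ∈ hatV d f g p.1 p.2 := by
    refine (Ultrafilter.finite_biUnion_mem_iff (Set.toFinite (signedSubsets n m l))).1 ?_
    filter_upwards [hcrit] with k hk
    simpa using hk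
  -- Normalizing `λ` to the unit sphere provides compactness and keeps the limit nonzero.
  have hunit : ∀ᶠ k in (u : Filter ℕ), ∃ v : {v : Option p.1 → ℂ // v ≠ 0},
      v.1 ∈ Metric.sphere 0 1 ∧
        mkPoint ⟨(t k : ℂ), fun j => (x k j : ℂ), v⟩ ∈ hatV d f g p.1 p.2 := by
    filter_upwards [hcrit] with k ⟨⟨v, hv⟩, hk⟩
    have hnorm : (‖v‖ : ℂ) ≠ 0 := by simpa using hv
    have hv' : (‖v‖ : ℂ)⁻¹ • v ≠ 0 := smul_ne_zero (inv_ne_zero hnorm) hv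
    refine ⟨⟨(‖v‖ : ℂ)⁻¹ • v, hv'⟩, ?_, ?_⟩
    · rw [mem_sphere_zero_iff_norm, norm_smul, norm_inv, Complex.norm_real, norm_norm,
        inv_mul_cancel₀ (norm_ne_zero_iff.2 hv)]
    · have : Projectivization.mk ℂ _ hv' = Projectivization.mk ℂ v hv :=
        (Projectivization.mk_eq_mk_iff' ℂ _ _ _ _).2 ⟨_, rfl⟩
      simpa only [mkPoint, this] using hk
  have : Nonempty {v : Option p.1 → ℂ // v ≠ 0} := let ⟨_, v, _⟩ := hunit.exists; ⟨v⟩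
  obtain ⟨v, hv⟩ := hunit.choice
  obtain ⟨v₀, hv₀, hvlim⟩ := (isCompact_sphere (0 : Option p.1 → ℂ) 1).ultrafilter_le_nhds
    (u.map fun k => (v k).1)
    (tendsto_principal.2 (hv.mono fun k hk => hk.1) : Tendsto (fun k => (v k).1) u (𝓟 _))
  have hv₀0 : v₀ ≠ 0 := by
    rintro rfl
    simp at hv₀
  have hvu : Tendsto (fun k => (v k).1) u (𝓝 v₀) := hvlim
  have hlim : Tendsto (fun k => ((t k : ℂ), (fun j => (x k j : ℂ)), v k)) u
      (𝓝 ((1 : ℂ), (fun j => (x₀ j : ℂ)), ⟨v₀, hv₀0⟩)) := by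
    refine Tendsto.prodMk_nhds ?_ (Tendsto.prodMk_nhds ?_ (tendsto_subtype_rng.2 hvu))
    · exact Complex.ofReal_one ▸ (Complex.continuous_ofReal.tendsto 1).comp htu
    · exact tendsto_pi_nhds.2 fun j =>
        (Complex.continuous_ofReal.tendsto _).comp ((tendsto_pi_nhds.1 hxu) j)
  refine ⟨x₀, hLU hx₀L, Set.mem_biUnion hp ⟨_, ⟨mkPoint_mem_V_of_tendsto hlim ?_ ?_, rfl⟩, rfl⟩⟩
  · exact hv.mono fun k hk => hk.2
  · refine Eventually.of_forall fun k => ?_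
    exact fun h => (ht1 k).ne (Complex.ofReal_eq_one.1 h)

end Limit

/-- Excludes `d = 0`: with constant polynomials, a nonempty set of minimizers is all of `ℝⁿ`, which
is connected and not compact. -/
theorem not_isCompact_component_of_constant {K : Subfield ℝ} {n m l : ℕ} (hn : 2 ≤ n)
    {f : Fin m → MvPolynomial (Fin n) K} {g : MvPolynomial (Fin n) K}
    (hf : ∀ i, (f i).totalDegree ≤ 0) (hg : g.totalDegree ≤ 0) (gmin : ℝ) {C : Set (Fin n → ℝ)}
    (hC : IsConnectedComponentOf C (minimizerSet (feasibleSet l f) g gmin)) : ¬ IsCompact C := by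
  have hconst : ∀ p : MvPolynomial (Fin n) K, p.totalDegree ≤ 0 → ∀ x y : Fin n → ℝ,
      aeval x p = aeval y p := fun p hp x y => by
    rw [totalDegree_eq_zero_iff_eq_C.1 (Nat.le_zero.1 hp)]
    simp
  obtain ⟨x, hx, rfl⟩ := hC
  have huniv : minimizerSet (feasibleSet l f) g gmin = Set.univ := by
    refine Set.eq_univ_of_forall fun y => ?_
    obtain ⟨⟨h1, h2⟩, h3⟩ := hx
    refine ⟨⟨fun i hi => ?_, fun i hi => ?_⟩, ?_⟩
    · rw [hconst _ (hf i) y x, h1 i hi]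
    · rw [hconst _ (hf i) y x]
      exact h2 i hi
    · rw [hconst _ hg y x]
      exact h3
  rw [huniv, connectedComponentIn_univ, PreconnectedSpace.connectedComponent_eq_univ]
  have : Nonempty (Fin n) := ⟨⟨0, by omega⟩⟩
  exact noncompact_univ _

end PolyMin

theorem mainTheorem4 (K : Subfield ℝ) (n m l d : ℕ) (hn : 2 ≤ n) (hl : l ≤ m) (hd : Even d)
    (f : Fin m → MvPolynomial (Fin n) K) (g : MvPolynomial (Fin n) K)
    (hf : ∀ i, (f i).totalDegree ≤ d) (hg : g.totalDegree ≤ d)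
    (gmin : ℝ)
    (hgmin : IsLeast ((fun x : Fin n → ℝ => MvPolynomial.aeval x g) '' PolyMin.feasibleSet l f)
      gmin)
    (hcomp : ∃ C : Set (Fin n → ℝ),
      PolyMin.IsConnectedComponentOf C
        (PolyMin.minimizerSet (PolyMin.feasibleSet l f) g gmin) ∧ IsCompact C) :
    (PolyMin.sampleSet l d f g).Finite ∧
      ∀ C : Set (Fin n → ℝ),
        PolyMin.IsConnectedComponentOf C
          (PolyMin.minimizerSet (PolyMin.feasibleSet l f) g gmin) →
        IsCompact C →
        ∃ z ∈ C, (fun j => (z j : ℂ)) ∈ PolyMin.sampleSet l d f g := by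
  have hd2 : 2 ≤ d := by
    obtain ⟨C, hC, hCc⟩ := hcomp
    rcases Nat.eq_zero_or_pos d with rfl | hpos
    · exact absurd hCc (PolyMin.not_isCompact_component_of_constant hn hf hg gmin hC)
    · obtain ⟨k, rfl⟩ := hd
      omega
  have hfin := PolyMin.finite_sampleSet hd2 hf hg l
  refine ⟨hfin, fun C hC hCc => ?_⟩
  by_contra! hempty
  have hinj : Function.Injective fun (z : Fin n → ℝ) j => (z j : ℂ) := fun y z h =>
    funext fun j => Complex.ofReal_injective (congrFun h j)
  have hreal := hfin.preimage (hinj.injOn (s := _))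
  -- The real sample points form a finite, hence closed, set. If none lay in `C`, its complement
  -- would be a neighbourhood of `C` without sample points.
  obtain ⟨z, hz, hz'⟩ := PolyMin.exists_mem_sampleSet hd hgmin.2 hC hCc hreal.isClosed.isOpen_compl
    fun z hz => hempty z hz
  exact hz hz'
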